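/- Let $V$ be a Euclidean vector space of dimension $n$ with inner product $(\cdot,\cdot)$. For a convex polyhedral cone $K$ in a Euclidean space write $\langle K\rangle$ for its linear span, $\dim K=\dim\langle K\rangle$, and let $\sigma(K)=\operatorname{vol}(K\cap B)/\operatorname{vol}(B)$ be its relative angle measure, where $B$ is the unit ball of $\langle K\rangle$ centered at the origin and the volume is that of $\langle K\rangle$ (so $\sigma(\{0\})=1$). Let $W\subset O(V)$ be a finite reflection group, i.e. a finite group generated by orthogonal reflections in hyperplanes, and let $C$ be a fundamental cone of $W$, i.e. the closure of a connected component of the complement in $V$ of the union of all reflection hyperplanes of $W$. For a face $F$ of $C$ let $C/F$ be the orthogonal projection of $C$ to $\langle F\rangle^{\perp}$, and let $(C/F)^*=\{v\in\langle F\rangle^{\perp} : (v,u)\ge 0 \text{ for all } u\in C/F\}$ be its dual cone in $\langle F\rangle^{\perp}$. For $0\le k\le n$ put $W^k=\{w\in W:\dim\ker(1-w)=k\}$. Theorem. For each $k=0,\ldots,n$, the cone $C$ has finitely many $k$-dimensional faces, and $$\sum_{F\subset C,\ \dim F=k}\sigma(F)\cdot\sigma\bigl((C/F)^*\bigr)=\frac{|W^{k}|}{|W|},$$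 where $F$ runs over the $k$-dimensional faces of $C$ (including $C$ itself when $k=n$). -/

import Mathlib

open Module MeasureTheory

namespace ReflectionCone

noncomputable section

section AngleMeasure

variable {E : Type*} [NormedAddCommGroup E] [InnerProductSpace ℝ E] [FiniteDimensional ℝ E]

/-- The linear span `⟨C⟩` of a convex cone `C`. -/
def linSpan (C : PointedCone ℝ E) : Submodule ℝ E := Submodule.span ℝ (C : Set E)

/-- The dimension of a convex cone, i.e. the dimension of its linear span. -/
def dim (C : PointedCone ℝ E) : ℕ := finrank ℝ (linSpan C)

/-- Lebesgue measure of a Euclidean space (on its Borel sets), normalized by the cube spanned by an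
orthonormal basis. This is Mathlib's `volume` of a finite-dimensional inner product space, spelled
out so that it is never confused with the restriction of the volume of an ambient space. -/
def vol (E : Type*) [NormedAddCommGroup E] [InnerProductSpace ℝ E] [FiniteDimensional ℝ E] :
    @Measure E (borel E) :=
  letI : MeasurableSpace E := borel E
  haveI : BorelSpace E := ⟨rfl⟩
  (stdOrthonormalBasis ℝ E).toBasis.addHaar

/-- The relative angle measure `σ(C) = vol (C ∩ B) / vol B`, where `B` is the unit ball of the
linear span of `C` and the volume is that of the linear span. -/
def angleMeasure (C : PointedCone ℝ E) : ℝ :=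
  (vol (linSpan C)
      ({x : linSpan C | (x : E) ∈ C} ∩ Metric.closedBall (0 : linSpan C) 1)).toReal /
    (vol (linSpan C) (Metric.closedBall (0 : linSpan C) 1)).toReal

/-- The dual cone `C* = {v | (v, u) ≥ 0 for all u ∈ C}` in the Euclidean space `E`. -/
def dualCone (C : PointedCone ℝ E) : PointedCone ℝ E :=
  (ProperCone.innerDual (C : Set E)).toPointedCone

/-- The cone `C/F`: the orthogonal projection of `C` to the orthogonal complement of the linear span
of `F`, regarded as a cone in the Euclidean space `⟨F⟩ᗮ`. -/
def coneQuot (C F : PointedCone ℝ E) : PointedCone ℝ (linSpan F)ᗮ :=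
  C.map ((linSpan F)ᗮ.orthogonalProjectionOnto : E →ₗ[ℝ] (linSpan F)ᗮ)

/-- The set of all `k`-dimensional faces of the cone `C`. -/
def faces (C : PointedCone ℝ E) (k : ℕ) : Set (PointedCone ℝ E) :=
  {F | F.IsFaceOf C ∧ dim F = k}

end AngleMeasure

section ReflectionGroup

variable {V : Type*} [NormedAddCommGroup V] [InnerProductSpace ℝ V] [FiniteDimensional ℝ V]

/-- A finite reflection group: a finite group of linear isometries of a Euclidean space that is
generated by orthogonal reflections in hyperplanes. -/
structure IsFiniteReflectionGroup (W : Subgroup (V ≃ₗᵢ[ℝ] V)) : Prop where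
  finite : Finite W
  closure_reflections :
    Subgroup.closure {s : V ≃ₗᵢ[ℝ] V | s ∈ W ∧ ∃ v : V, v ≠ 0 ∧ s = (ℝ ∙ v)ᗮ.reflection} = W

/-- The complement of the union of all reflection hyperplanes of `W`. -/
def regularPoints (W : Subgroup (V ≃ₗᵢ[ℝ] V)) : Set V :=
  {x | ∀ v : V, v ≠ 0 → (ℝ ∙ v)ᗮ.reflection ∈ W → x ∉ (ℝ ∙ v)ᗮ}

/-- A fundamental cone (closed Weyl chamber) of `W`: the closure of a connected component of the
complement of the union of the reflection hyperplanes. -/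
def IsFundamentalCone (W : Subgroup (V ≃ₗᵢ[ℝ] V)) (C : PointedCone ℝ V) : Prop :=
  ∃ x ∈ regularPoints W, (C : Set V) = closure (connectedComponentIn (regularPoints W) x)

/-- The set `W^k` of all elements of `W` whose fixed space `ker (1 - w)` has dimension `k`. -/
def fixedDim (W : Subgroup (V ≃ₗᵢ[ℝ] V)) (k : ℕ) : Set (V ≃ₗᵢ[ℝ] V) :=
  {w | w ∈ W ∧
    finrank ℝ (LinearMap.ker (LinearMap.id - (w.toLinearEquiv : V →ₗ[ℝ] V))) = k}

end ReflectionGroup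

end

end ReflectionCone

/-! ### Dirichlet domains of finite isometry groups, their faces and localizations. -/

namespace ReflectionCone

section

open scoped InnerProductSpace

section ConeLemmas

variable {E : Type*} [NormedAddCommGroup E] [InnerProductSpace ℝ E]

/-! Only three properties of the fundamental cone enter the angle computation (`IsDirichlet`): W is
finite, the translates of C cover V, and ⟪w y, c⟫ ≤ ⟪y, c⟫ for y, c in C. They pass from (W, C) to
(W_F, C + ⟨F⟩), where W_F is the pointwise stabilizer of a face F (`localize`), which makes
induction on |W| possible. Angles are replaced by Gaussian measures, whose orthogonal components are
independent.

Let γ(F) be the Gaussian measure of F in ⟨F⟩ and γ*(F) that of C* in ⟨F⟩ᗮ. Sorting the points of V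
by the face that carries their nearest point in C gives ∑ γ(F) γ*(F) = 1
(`sum_gam_mul_gam_dualCone`). On the other hand, the translates of C cover almost every point of a
subspace X exactly |W_X| times. Averaging this over the fixed spaces of a conjugation-stable set A ⊆
W, where only fixed spaces spanned by faces contribute, gives |A|/|W| = ∑ γ(F) #{w ∈ A : Fix w =
⟨F⟩}/|W_F| (`card_eq_mul_sum_gam`, `sum_fixedSpace_eq_sum_faces`).

For A = W both sums equal 1. By induction they agree term by term at all faces with W_F ≠ W, hence
also at the one remaining face, the minimal one (`gam_dualCone`). Localizing, γ*(F) = #{w : Fix w =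
⟨F⟩}/|W_F| for every face, and the choice A = W^k yields the theorem. That a chamber is a Dirichlet
domain follows from the exchange condition for simple reflections. -/

lemma subset_linSpan (K : PointedCone ℝ E) {x : E} (hx : x ∈ K) : x ∈ linSpan K :=
  Submodule.subset_span hx

/-- A cone in a finite-dimensional space contains a finite family spanning its linear span. -/
lemma exists_finset_span_eq_linSpan [FiniteDimensional ℝ E] (K : PointedCone ℝ E) :
    ∃ s : Finset E, (∀ x ∈ s, x ∈ K) ∧ Submodule.span ℝ (s : Set E) = linSpan K := by
  obtain ⟨s, hs, hspan⟩ := Submodule.fg_span_iff_fg_span_finset_subset (R := ℝ) (K : Set E) |>.1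
    (IsNoetherian.noetherian _)
  exact ⟨s, fun x hx => hs hx, hspan.symm⟩

/-- Every vector of the span is a difference of two vectors of F, so x + a ∈ F for some a ∈ F, and
the face property returns x. -/
lemma inter_linSpan_of_isFaceOf {F C : PointedCone ℝ E} (hF : F.IsFaceOf C) {x : E}
    (hx : x ∈ C) (hxF : x ∈ linSpan F) : x ∈ F := by
  have key : ∀ y ∈ linSpan F, ∃ a ∈ F, y + a ∈ F := by
    intro y hy
    induction hy using Submodule.span_induction with
    | mem y hy => exact ⟨0, F.zero_mem, by simpa using hy⟩
    | zero => exact ⟨0, F.zero_mem, by simp⟩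
    | add y z _ _ hy hz =>
      obtain ⟨a, ha, hya⟩ := hy
      obtain ⟨b, hb, hzb⟩ := hz
      exact ⟨a + b, F.add_mem ha hb, by
        have := F.add_mem hya hzb
        rwa [add_add_add_comm] at this⟩
    | smul r y _ hy =>
      obtain ⟨a, ha, hya⟩ := hy
      rcases le_total 0 r with hr | hr
      · refine ⟨r • a, F.smul_mem hr ha, ?_⟩
        rw [← smul_add]
        exact F.smul_mem hr hya
      · refine ⟨(-r) • (y + a), F.smul_mem (by linarith) hya, ?_⟩
        have : r • y + (-r) • (y + a) = (-r) • a := by module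
        rw [this]
        exact F.smul_mem (by linarith) ha
  obtain ⟨a, ha, hxa⟩ := key x hxF
  refine hF.mem_of_smul_add_mem hx (hF.le ha) one_pos (by simpa using hxa)

end ConeLemmas

variable {V : Type*} [NormedAddCommGroup V] [InnerProductSpace ℝ V]

lemma inner_inv_apply (g : V ≃ₗᵢ[ℝ] V) (x y : V) : ⟪g⁻¹ x, y⟫_ℝ = ⟪x, g y⟫_ℝ := by
  rw [← g.inner_map_map (g⁻¹ x) y]
  congr 1
  exact g.apply_symm_apply x

lemma inv_apply_eq_of_apply_eq {g : V ≃ₗᵢ[ℝ] V} {x y : V} (h : g x = y) : g⁻¹ y = x := by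
  rw [← h]; exact g.symm_apply_apply x

/-- The subspace of vectors fixed by `w`. -/
def fixedSpace (w : V ≃ₗᵢ[ℝ] V) : Submodule ℝ V :=
  LinearMap.ker (LinearMap.id - (w.toLinearEquiv : V →ₗ[ℝ] V))

@[simp] lemma mem_fixedSpace {w : V ≃ₗᵢ[ℝ] V} {x : V} : x ∈ fixedSpace w ↔ w x = x := by
  rw [fixedSpace, LinearMap.mem_ker, eq_comm (a := w x)]
  exact sub_eq_zero

/-- The elements of `W` fixing the subspace `X` pointwise. -/
def fixer (W : Subgroup (V ≃ₗᵢ[ℝ] V)) (X : Submodule ℝ V) : Subgroup (V ≃ₗᵢ[ℝ] V) where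
  carrier := {w | w ∈ W ∧ X ≤ fixedSpace w}
  one_mem' := ⟨W.one_mem, fun x _ => by simp⟩
  mul_mem' := fun {a b} ha hb => ⟨W.mul_mem ha.1 hb.1, fun x hx => by
    have h1 := mem_fixedSpace.1 (ha.2 hx)
    have h2 := mem_fixedSpace.1 (hb.2 hx)
    simp [h1, h2]⟩
  inv_mem' := fun {a} ha => ⟨W.inv_mem ha.1, fun x hx =>
    mem_fixedSpace.2 (inv_apply_eq_of_apply_eq (mem_fixedSpace.1 (ha.2 hx)))⟩

lemma mem_fixer {W : Subgroup (V ≃ₗᵢ[ℝ] V)} {X : Submodule ℝ V} {w : V ≃ₗᵢ[ℝ] V} :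
    w ∈ fixer W X ↔ w ∈ W ∧ X ≤ fixedSpace w := Iff.rfl

/-- The subspace of vectors fixed by all elements of `W`. -/
def commonFixed (W : Subgroup (V ≃ₗᵢ[ℝ] V)) : Submodule ℝ V := ⨅ w ∈ W, fixedSpace w

lemma mem_commonFixed {W : Subgroup (V ≃ₗᵢ[ℝ] V)} {x : V} :
    x ∈ commonFixed W ↔ ∀ w ∈ W, w x = x := by
  simp [commonFixed, Submodule.mem_iInf]

/-- A subspace regarded as a cone. -/
abbrev toCone (X : Submodule ℝ V) : PointedCone ℝ V := X.restrictScalars _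

/-- `C` is a cone whose translates under the finite group `W` cover the space and each of whose
points has maximal inner product with `C` among the points of its orbit. -/
structure IsDirichlet (W : Subgroup (V ≃ₗᵢ[ℝ] V)) (C : PointedCone ℝ V) : Prop where
  finite : Finite W
  cover : ∀ y, ∃ g ∈ W, g y ∈ C
  inner_le : ∀ w ∈ W, ∀ y ∈ C, ∀ c ∈ C, ⟪w y, c⟫_ℝ ≤ ⟪y, c⟫_ℝ

namespace IsDirichlet

variable {W : Subgroup (V ≃ₗᵢ[ℝ] V)} {C : PointedCone ℝ V}

/-- Testing `inner_le` against c = w y gives ‖y‖² ≤ ⟪y, w y⟫, the equality case of Cauchy–Schwarz.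
Hence C meets each orbit once. -/
lemma fixed_of_mem (h : IsDirichlet W C) {w : V ≃ₗᵢ[ℝ] V} (hw : w ∈ W) {y : V} (hy : y ∈ C)
    (hwy : w y ∈ C) : w y = y := by
  have h1 := h.inner_le w hw y hy (w y) hwy
  have h2 : ⟪w y, w y⟫_ℝ = ⟪y, y⟫_ℝ := w.inner_map_map y y
  have h3 : ⟪w y - y, w y - y⟫_ℝ ≤ 0 := by
    rw [inner_sub_left, inner_sub_right, inner_sub_right, real_inner_comm y (w y)] at *
    linarith
  exact sub_eq_zero.1 (inner_self_eq_zero.1 (le_antisymm h3 real_inner_self_nonneg))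

/-- V is the union of the finitely many translates of ⟨C⟩, and a real vector space is not a finite
union of proper subspaces. -/
lemma linSpan_eq_top (h : IsDirichlet W C) : linSpan C = ⊤ := by
  classical
  have := h.finite
  have hfin : (W : Set (V ≃ₗᵢ[ℝ] V)).Finite := Set.toFinite _
  let s : Finset (Submodule ℝ V) :=
    hfin.toFinset.image fun g => (linSpan C).comap (g.toLinearEquiv : V →ₗ[ℝ] V)
  have hcov : ⋃ p ∈ s, (p : Set V) = Set.univ := by
    refine Set.eq_univ_of_forall fun y => ?_
    obtain ⟨g, hg, hy⟩ := h.cover y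
    refine Set.mem_iUnion₂.2 ⟨(linSpan C).comap (g.toLinearEquiv : V →ₗ[ℝ] V), ?_, ?_⟩
    · exact Finset.mem_image_of_mem _ (hfin.mem_toFinset.2 hg)
    · exact subset_linSpan C hy
  obtain ⟨g, -, hg⟩ := Finset.mem_image.1 (Subspace.top_mem_of_biUnion_eq_univ hcov)
  rw [eq_top_iff]
  intro x _
  have : g⁻¹ x ∈ (linSpan C).comap (g.toLinearEquiv : V →ₗ[ℝ] V) := hg ▸ Submodule.mem_top
  have h2 : g (g⁻¹ x) ∈ linSpan C := this
  rwa [show g (g⁻¹ x) = x from g.apply_symm_apply x] at h2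

lemma fixed_of_inner (h : IsDirichlet W C) {w : V ≃ₗᵢ[ℝ] V} {z : V}
    (hz : ∀ c ∈ C, ⟪z - w z, c⟫_ℝ = 0) : w z = z := by
  have : z - w z ∈ (linSpan C)ᗮ := by
    rw [Submodule.mem_orthogonal']
    intro u hu
    induction hu using Submodule.span_induction with
    | mem y hy => exact hz y hy
    | zero => simp
    | add y z _ _ hy hz => rw [inner_add_right, hy, hz, add_zero]
    | smul r y _ hy => rw [inner_smul_right, hy, mul_zero]
  rw [h.linSpan_eq_top, Submodule.top_orthogonal_eq_bot, Submodule.mem_bot, sub_eq_zero] at this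
  exact this.symm

/-- Against each c ∈ C, the defects x - w x and y - w y have nonnegative inner products that sum to
zero; C spans, so both defects vanish. -/
lemma fixed_of_add_fixed (h : IsDirichlet W C) {w : V ≃ₗᵢ[ℝ] V} (hw : w ∈ W) {x y : V}
    (hx : x ∈ C) (hy : y ∈ C) (hxy : w (x + y) = x + y) : w x = x := by
  refine h.fixed_of_inner fun c hc => ?_
  have h1 := h.inner_le w hw x hx c hc
  have h2 := h.inner_le w hw y hy c hc
  have h3 : ⟪w (x + y), c⟫_ℝ = ⟪x + y, c⟫_ℝ := by rw [hxy]
  rw [map_add, inner_add_left, inner_add_left] at h3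
  rw [inner_sub_left]; linarith

lemma fixed_of_sum_fixed (h : IsDirichlet W C) {w : V ≃ₗᵢ[ℝ] V} (hw : w ∈ W) {s : Finset V}
    (hs : ∀ x ∈ s, x ∈ C) (hf : w (∑ x ∈ s, x) = ∑ x ∈ s, x) {x : V} (hx : x ∈ s) : w x = x := by
  classical
  rw [← Finset.add_sum_erase s _ hx] at hf
  exact h.fixed_of_add_fixed hw (hs x hx)
    (sum_mem fun y hy => hs y (Finset.mem_of_mem_erase hy)) hf

/-- The intersection with the fixed space of an element of `W` is a face. -/
lemma isFaceOf_inf_fixedSpace (h : IsDirichlet W C) {w : V ≃ₗᵢ[ℝ] V} (hw : w ∈ W) :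
    (C ⊓ toCone (fixedSpace w)).IsFaceOf C where
  le := inf_le_left
  mem_of_smul_add_mem := by
    intro x y a hx hy ha hxy
    refine ⟨hx, ?_⟩
    have h1 : w (a • x + y) = a • x + y := mem_fixedSpace.1 hxy.2
    have h2 := h.fixed_of_add_fixed hw (C.smul_mem ha.le hx) hy h1
    rw [map_smul] at h2
    exact mem_fixedSpace.2 (smul_right_injective V ha.ne' h2)

lemma isFaceOf_inf_commonFixed (h : IsDirichlet W C) {G : Subgroup (V ≃ₗᵢ[ℝ] V)} (hG : G ≤ W) :
    (C ⊓ toCone (commonFixed G)).IsFaceOf C where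
  le := inf_le_left
  mem_of_smul_add_mem := by
    intro x y a hx hy ha hxy
    refine ⟨hx, mem_commonFixed.2 fun w hw => ?_⟩
    have h1 : a • x + y ∈ C ⊓ toCone (fixedSpace w) :=
      ⟨hxy.1, mem_fixedSpace.2 (mem_commonFixed.1 hxy.2 w hw)⟩
    exact mem_fixedSpace.1
      ((h.isFaceOf_inf_fixedSpace (hG hw)).mem_of_smul_add_mem hx hy ha h1).2

lemma commonFixed_le (h : IsDirichlet W C) {x : V} (hx : x ∈ commonFixed W) : x ∈ C := by
  obtain ⟨g, hg, hgx⟩ := h.cover x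
  rwa [mem_commonFixed.1 hx g hg] at hgx

/-- `C` is the Dirichlet domain of any of its separating vectors. -/
lemma mem_iff (h : IsDirichlet W C) {c₀ : V} (hc₀ : c₀ ∈ C)
    (hsep : ∀ w ∈ W, ∀ z ∈ C, ⟪z - w z, c₀⟫_ℝ = 0 → w z = z) {x : V} :
    x ∈ C ↔ ∀ w ∈ W, 0 ≤ ⟪x, c₀ - w c₀⟫_ℝ := by
  constructor
  · intro hx w hw
    have := h.inner_le w hw c₀ hc₀ x hx
    rw [inner_sub_right, real_inner_comm, real_inner_comm (w c₀)]; linarith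
  · intro hx
    obtain ⟨g, hg, hgx⟩ := h.cover x
    -- The hypothesis on x and `inner_le` at g x are opposite inequalities, so equality holds and
    -- separation forces g⁻¹ to fix g x.
    have h1 := hx g⁻¹ (W.inv_mem hg)
    have h2 := h.inner_le g⁻¹ (W.inv_mem hg) _ hgx c₀ hc₀
    have h3 : g⁻¹ (g x) = x := g.symm_apply_apply x
    have h4 : ⟪x, g⁻¹ c₀⟫_ℝ = ⟪g x, c₀⟫_ℝ := by
      rw [real_inner_comm, inner_inv_apply, real_inner_comm]
    have h5 := hsep g⁻¹ (W.inv_mem hg) _ hgx (by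
      rw [inner_sub_left, h3]; rw [inner_sub_right, h4] at h1; rw [h3] at h2; linarith)
    rw [h3] at h5
    rwa [← h5] at hgx

variable [FiniteDimensional ℝ V]

/-- A subcone of `C` has a point with the same stabilizer as the whole subcone. -/
lemma exists_generic (h : IsDirichlet W C) {F : PointedCone ℝ V} (hF : F ≤ C) :
    ∃ f ∈ F, ∀ w ∈ W, w f = f → w ∈ fixer W (linSpan F) := by
  obtain ⟨s, hs, hspan⟩ := exists_finset_span_eq_linSpan F
  refine ⟨∑ x ∈ s, x, sum_mem hs, fun w hw hwf => ⟨hw, ?_⟩⟩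
  rw [← hspan, Submodule.span_le]
  exact fun x hx => mem_fixedSpace.2 (h.fixed_of_sum_fixed hw (fun y hy => hF (hs y hy)) hwf hx)

/-- There is a vector of `C` that detects, by its inner products, whether points of `C` are
fixed. -/
lemma exists_separating (h : IsDirichlet W C) :
    ∃ c₀ ∈ C, ∀ w ∈ W, ∀ z ∈ C, ⟪z - w z, c₀⟫_ℝ = 0 → w z = z := by
  obtain ⟨s, hs, hspan⟩ := exists_finset_span_eq_linSpan C
  refine ⟨∑ x ∈ s, x, sum_mem hs, fun w hw z hz h0 => ?_⟩
  rw [inner_sum] at h0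
  have hnn : ∀ x ∈ s, 0 ≤ ⟪z - w z, x⟫_ℝ := fun x hx => by
    rw [inner_sub_left]; linarith [h.inner_le w hw z hz x (hs x hx)]
  have hz0 := (Finset.sum_eq_zero_iff_of_nonneg hnn).1 h0
  have : z - w z ∈ (Submodule.span ℝ (s : Set V))ᗮ := by
    rw [Submodule.mem_orthogonal']
    intro u hu
    induction hu using Submodule.span_induction with
    | mem y hy => exact hz0 y hy
    | zero => simp
    | add y z _ _ hy hz => rw [inner_add_right, hy, hz, add_zero]
    | smul r y _ hy => rw [inner_smul_right, hy, mul_zero]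
  rw [hspan, h.linSpan_eq_top, Submodule.top_orthogonal_eq_bot, Submodule.mem_bot,
    sub_eq_zero] at this
  exact this.symm

lemma isClosed (h : IsDirichlet W C) : IsClosed (C : Set V) := by
  obtain ⟨c₀, hc₀, hsep⟩ := h.exists_separating
  have : (C : Set V) = ⋂ w ∈ W, {x | 0 ≤ ⟪x, c₀ - w c₀⟫_ℝ} := by
    ext x; simp only [Set.mem_iInter]; exact h.mem_iff hc₀ hsep
  rw [this]
  exact isClosed_biInter fun w _ => isClosed_le continuous_const (by fun_prop)

/-- The linear span of a face is the space of vectors fixed by the pointwise stabilizer of the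
face. -/
lemma commonFixed_fixer_linSpan (h : IsDirichlet W C) {F : PointedCone ℝ V} (hF : F.IsFaceOf C) :
    commonFixed (fixer W (linSpan F)) = linSpan F := by
  apply le_antisymm
  · intro y hy
    obtain ⟨c₀, hc₀, hsep⟩ := h.exists_separating
    obtain ⟨f, hfF, hf⟩ := h.exists_generic hF.le
    have hfC := hF.le hfF
    have hfin := h.finite
    -- An inequality defining C is either tight at f, and then w⁻¹ fixes f, hence y, so it is tight
    -- at y too; or strict at f, and then a large N dominates y. Thus N f ± y ∈ C, and their sum 2N
    -- f lies in F.
    have key : ∀ w ∈ W, ∀ᶠ N : ℝ in Filter.atTop, 0 ≤ ⟪N • f + y, c₀ - w c₀⟫_ℝ ∧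
        0 ≤ ⟪N • f - y, c₀ - w c₀⟫_ℝ := by
      intro w hw
      have hnn := (h.mem_iff hc₀ hsep).1 hfC w hw
      by_cases hwf : w⁻¹ f = f
      · have hw' := hf _ (W.inv_mem hw) hwf
        have h1 : w⁻¹ y = y := mem_commonFixed.1 hy _ hw'
        have h2 : ⟪y, c₀ - w c₀⟫_ℝ = 0 := by
          rw [inner_sub_right, ← inner_inv_apply, h1, sub_self]
        filter_upwards [Filter.eventually_ge_atTop 0] with N hN
        rw [inner_add_left, inner_sub_left, inner_smul_left, h2]
        simp only [conj_trivial, add_zero, sub_zero, and_self]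
        positivity
      · have hpos : 0 < ⟪f, c₀ - w c₀⟫_ℝ := by
          refine lt_of_le_of_ne hnn fun h0 => hwf (hsep _ (W.inv_mem hw) f hfC ?_)
          rw [inner_sub_left, inner_inv_apply, ← inner_sub_right, ← h0]
        filter_upwards [Filter.eventually_ge_atTop (|⟪y, c₀ - w c₀⟫_ℝ| / ⟪f, c₀ - w c₀⟫_ℝ)]
          with N hN
        rw [div_le_iff₀ hpos] at hN
        rw [inner_add_left, inner_sub_left, inner_smul_left]
        simp only [conj_trivial]
        constructor <;> linarith [neg_abs_le ⟪y, c₀ - w c₀⟫_ℝ, le_abs_self ⟪y, c₀ - w c₀⟫_ℝ]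
    have key2 : ∀ᶠ N : ℝ in Filter.atTop, ∀ w : W, 0 ≤ ⟪N • f + y, c₀ - w.1 c₀⟫_ℝ ∧
        0 ≤ ⟪N • f - y, c₀ - w.1 c₀⟫_ℝ := Filter.eventually_all.2 fun w => key w.1 w.2
    obtain ⟨N, hN, hN0⟩ := (key2.and (Filter.eventually_ge_atTop 0)).exists
    have h1 : N • f + y ∈ C := (h.mem_iff hc₀ hsep).2 fun w hw => (hN ⟨w, hw⟩).1
    have h2 : N • f - y ∈ C := (h.mem_iff hc₀ hsep).2 fun w hw => (hN ⟨w, hw⟩).2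
    have h3 : N • f + y ∈ F := by
      refine hF.mem_of_smul_add_mem h1 h2 one_pos ?_
      have : (1 : ℝ) • (N • f + y) + (N • f - y) = (2 * N) • f := by module
      rw [this]
      exact F.smul_mem (by positivity) hfF
    have h4 := subset_linSpan F h3
    rwa [Submodule.add_mem_iff_right _ (Submodule.smul_mem _ _ (subset_linSpan F hfF))] at h4
  · intro y hy
    exact mem_commonFixed.2 fun w hw => mem_fixedSpace.1 (hw.2 hy)

lemma face_eq (h : IsDirichlet W C) {F : PointedCone ℝ V} (hF : F.IsFaceOf C) :
    F = C ⊓ toCone (commonFixed (fixer W (linSpan F))) := by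
  ext x
  rw [h.commonFixed_fixer_linSpan hF]
  exact ⟨fun hx => ⟨hF.le hx, subset_linSpan F hx⟩, fun hx => inter_linSpan_of_isFaceOf hF hx.1 hx.2⟩

/-- A face is recovered from its pointwise stabilizer, and W has finitely many subgroups. -/
lemma finite_faces (h : IsDirichlet W C) : {F : PointedCone ℝ V | F.IsFaceOf C}.Finite := by
  have hfin := h.finite
  have hW : (W : Set (V ≃ₗᵢ[ℝ] V)).Finite := Set.toFinite _
  have hS : {G : Subgroup (V ≃ₗᵢ[ℝ] V) | G ≤ W}.Finite :=
    Set.Finite.of_finite_image (f := fun G : Subgroup (V ≃ₗᵢ[ℝ] V) => (G : Set (V ≃ₗᵢ[ℝ] V)))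
      (hW.finite_subsets.subset (by rintro _ ⟨G, hG, rfl⟩; exact hG)) SetLike.coe_injective.injOn
  refine (hS.image fun G => C ⊓ toCone (commonFixed G)).subset fun F hF => ?_
  exact ⟨fixer W (linSpan F), fun w hw => hw.1, (h.face_eq hF).symm⟩

/-- The cone `C + ⟨F⟩` of a face `F` of `C` belongs to the pointwise stabilizer of `F`. -/
lemma localize (h : IsDirichlet W C) {F : PointedCone ℝ V} (hF : F.IsFaceOf C) :
    IsDirichlet (fixer W (linSpan F)) (C ⊔ toCone (linSpan F)) where
  finite := by
    have := h.finite
    exact Finite.Set.subset (W : Set (V ≃ₗᵢ[ℝ] V)) fun w hw => hw.1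
  cover := by
    intro y
    have := h.finite
    obtain ⟨f, hfF, hf⟩ := h.exists_generic hF.le
    -- Move y far in the direction of a generic f ∈ F. One w serves infinitely many N; dividing by N
    -- and using that C is closed gives w f ∈ C, so w f = f and w lies in the stabilizer of F. Then
    -- w y ∈ C - N f.
    choose g hg hgC using fun N : ℕ => h.cover (y + (N : ℝ) • f)
    obtain ⟨w, hw⟩ := Finite.exists_infinite_fiber (fun N => (⟨g N, hg N⟩ : W))
    have hinf : {N | g N = w.1}.Infinite := by
      rw [← Set.infinite_coe_iff]
      convert hw using 2
      ext N; simp [Subtype.ext_iff]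
    have hlim : Filter.Tendsto (fun N : ℕ => ((N : ℝ)⁻¹) • w.1 (y + (N : ℝ) • f)) Filter.atTop
        (nhds (w.1 f)) := by
      have h1 : Filter.Tendsto (fun N : ℕ => ((N : ℝ)⁻¹) • w.1 y + w.1 f) Filter.atTop
          (nhds ((0 : ℝ) • w.1 y + w.1 f)) :=
        ((tendsto_inv_atTop_nhds_zero_nat (𝕜 := ℝ)).smul_const _).add_const _
      rw [zero_smul, zero_add] at h1
      refine h1.congr' ?_
      filter_upwards [Filter.eventually_gt_atTop 0] with N hN
      have : (N : ℝ) ≠ 0 := by positivity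
      rw [map_add, map_smul, smul_add, smul_smul, inv_mul_cancel₀ this, one_smul]
    have hfreq : ∃ᶠ N : ℕ in Filter.atTop, ((N : ℝ)⁻¹) • w.1 (y + (N : ℝ) • f) ∈ C := by
      refine (Nat.frequently_atTop_iff_infinite.2 hinf).mono fun N hN => ?_
      refine C.smul_mem (by positivity) ?_
      rw [← show g N = w.1 from hN]
      exact hgC N
    have hwf : w.1 f ∈ C := h.isClosed.mem_of_frequently_of_tendsto hfreq hlim
    have hfix := h.fixed_of_mem w.2 (hF.le hfF) hwf
    refine ⟨w.1, hf _ w.2 hfix, ?_⟩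
    obtain ⟨N, hN⟩ := hinf.nonempty
    have h2 := hgC N
    rw [show g N = w.1 from hN, map_add, map_smul, hfix] at h2
    refine Submodule.mem_sup.2 ⟨_, h2, -((N : ℝ) • f), ?_, by abel⟩
    exact (linSpan F).neg_mem ((linSpan F).smul_mem _ (subset_linSpan F hfF))
  inner_le := by
    rintro w hw y hy c hc
    obtain ⟨a, ha, f, hf, rfl⟩ := Submodule.mem_sup.1 hy
    obtain ⟨b, hb, f', hf', rfl⟩ := Submodule.mem_sup.1 hc
    have h1 : w f = f := mem_fixedSpace.1 (hw.2 hf)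
    have h2 : w f' = f' := mem_fixedSpace.1 (hw.2 hf')
    have h3 : ⟪w a, f'⟫_ℝ = ⟪a, f'⟫_ℝ := by
      conv_lhs => rw [← h2]
      exact w.inner_map_map a f'
    have h4 := h.inner_le w hw.1 a ha b hb
    rw [map_add, h1, inner_add_left, inner_add_left, inner_add_right, inner_add_right a, h3]
    linarith

end IsDirichlet

end

end ReflectionCone

/-! ### Gaussian measures of cones and subspaces. -/

namespace ReflectionCone

section

open scoped InnerProductSpace ENNReal Pointwise

section Gauss

variable {E : Type*} [NormedAddCommGroup E] [InnerProductSpace ℝ E] [FiniteDimensional ℝ E]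

lemma vol_eq_volume [m : MeasurableSpace E] [BorelSpace E] (S : Set E) : vol E S = volume S := by
  obtain rfl : m = borel E := BorelSpace.measurable_eq
  let : MeasurableSpace E := borel E
  exact congrArg (fun μ : Measure E => μ S) (stdOrthonormalBasis ℝ E).addHaar_eq_volume

variable [MeasurableSpace E] [BorelSpace E]

/-- The Gaussian probability measure with density `exp (-π ‖x‖ ^ 2)`. -/
noncomputable def gauss (E : Type*) [NormedAddCommGroup E] [InnerProductSpace ℝ E]
    [FiniteDimensional ℝ E] [MeasurableSpace E] [BorelSpace E] : Measure E :=
  volume.withDensity fun x => ENNReal.ofReal (Real.exp (-Real.pi * ‖x‖ ^ 2))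

instance : IsProbabilityMeasure (gauss E) where
  measure_univ := by
    have h := GaussianFourier.integral_rexp_neg_mul_sq_norm (V := E) Real.pi_pos
    rw [div_self Real.pi_ne_zero, Real.one_rpow] at h
    have hi : Integrable fun v : E => Real.exp (-Real.pi * ‖v‖ ^ 2) :=
      Integrable.of_integral_ne_zero (by rw [h]; exact one_ne_zero)
    rw [gauss, withDensity_apply _ MeasurableSet.univ, Measure.restrict_univ,
      ← ofReal_integral_eq_lintegral_ofReal hi (.of_forall fun _ => (Real.exp_pos _).le), h,
      ENNReal.ofReal_one]

lemma gauss_absolutelyContinuous : gauss E ≪ volume := withDensity_absolutelyContinuous _ _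

lemma charFun_gauss (t : E) :
    charFun (gauss E) t = Complex.exp (-(‖t‖ ^ 2 : ℝ) / (4 * Real.pi)) := by
  have h := GaussianFourier.integral_cexp_neg_mul_sq_norm_add (V := E) (b := (Real.pi : ℂ))
    (by simpa using Real.pi_pos) Complex.I t
  rw [div_self (by exact_mod_cast Real.pi_ne_zero), Complex.one_cpow, one_mul, Complex.I_sq] at h
  rw [charFun_apply, gauss, integral_withDensity_eq_integral_toReal_smul (by fun_prop)
    (.of_forall fun _ => ENNReal.ofReal_lt_top)]
  convert h using 1
  · refine integral_congr_ae (.of_forall fun x => ?_)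
    simp only
    rw [ENNReal.toReal_ofReal (Real.exp_pos _).le, Complex.real_smul, Complex.ofReal_exp,
      ← Complex.exp_add, real_inner_comm]
    congr 1
    push_cast
    ring
  · push_cast
    congr 1
    ring

/-- The Gaussian measure of a cone is the proportion of the unit ball it occupies. -/
lemma gauss_mul_volume_closedBall {K : Set E} (hK : MeasurableSet K)
    (hcone : ∀ x ∈ K, ∀ r : ℝ, 0 < r → r • x ∈ K) :
    gauss E K * volume (Metric.closedBall (0 : E) 1) = volume (K ∩ Metric.closedBall (0 : E) 1) := by
  -- Layer-cake formula: the superlevel set of the density at t < 1 is a ball of radius √(-log t /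
  -- π), which a cone meets in a rescaled copy of its part in the unit ball. The resulting factor is
  -- the same for all cones, and the whole space determines it.
  set φ : ℝ → ℝ≥0∞ := fun t =>
    if t < 1 then ENNReal.ofReal (|Real.sqrt (-Real.log t / Real.pi) ^ finrank ℝ E|) else 0
  have key : ∀ L : Set E, MeasurableSet L → (∀ x ∈ L, ∀ r : ℝ, 0 < r → r • x ∈ L) →
      gauss E L = (∫⁻ t in Set.Ioi 0, φ t) * volume (L ∩ Metric.closedBall (0 : E) 1) := by
    intro L hL hLc
    have hfin : volume (L ∩ Metric.closedBall (0 : E) 1) ≠ ∞ :=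
      ((measure_mono Set.inter_subset_right).trans_lt measure_closedBall_lt_top).ne
    rw [gauss, withDensity_apply _ hL, lintegral_eq_lintegral_meas_le _
      (.of_forall fun _ => (Real.exp_pos _).le) (by fun_prop), ← lintegral_mul_const' _ _ hfin]
    -- At t = 1 the superlevel set is {0}, which has positive volume in dimension 0, whereas φ 1 =
    -- 0.
    have hne : ∀ᵐ t : ℝ ∂(volume.restrict (Set.Ioi 0)), t ≠ 1 :=
      ae_restrict_of_ae (compl_mem_ae_iff.2 (measure_singleton 1))
    refine lintegral_congr_ae ?_
    filter_upwards [hne, ae_restrict_mem measurableSet_Ioi] with t ht1 ht0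
    have ht0 : 0 < t := ht0
    rw [Measure.restrict_apply' hL]
    simp only [φ]
    have hset : {a : E | t ≤ Real.exp (-Real.pi * ‖a‖ ^ 2)} =
        {a : E | ‖a‖ ^ 2 ≤ -Real.log t / Real.pi} := by
      ext a
      simp only [Set.mem_ofPred_eq]
      rw [← Real.log_le_iff_le_exp ht0, le_div_iff₀ Real.pi_pos]
      constructor <;> intro h <;> linarith
    rw [hset]
    split_ifs with h1
    · have hpos : 0 < -Real.log t / Real.pi :=
        div_pos (neg_pos.2 (Real.log_neg ht0 h1)) Real.pi_pos
      set r := Real.sqrt (-Real.log t / Real.pi)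
      have hr : 0 < r := Real.sqrt_pos.2 hpos
      rw [← Measure.addHaar_smul]
      congr 1
      ext a
      simp only [Set.mem_inter_iff, Set.mem_ofPred_eq, Set.mem_smul_set_iff_inv_smul_mem₀ hr.ne',
        mem_closedBall_zero_iff, norm_smul, norm_inv, Real.norm_eq_abs, abs_of_pos hr]
      rw [inv_mul_le_iff₀ hr, mul_one, ← Real.le_sqrt (norm_nonneg _) hpos.le, and_comm]
      refine and_congr_left fun _ => ⟨fun h => hLc a h _ (inv_pos.2 hr), fun h => ?_⟩
      simpa [smul_smul, hr.ne'] using hLc _ h r hr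
    · have hneg : -Real.log t / Real.pi < 0 :=
        div_neg_of_neg_of_pos (neg_neg_of_pos (Real.log_pos (lt_of_le_of_ne (not_lt.1 h1)
          ht1.symm))) Real.pi_pos
      rw [zero_mul]
      convert measure_empty (μ := (volume : Measure E))
      ext a
      simp only [Set.mem_inter_iff, Set.mem_ofPred_eq, Set.mem_empty_iff_false, iff_false, not_and]
      intro h
      nlinarith [sq_nonneg ‖a‖]
  have h1 := key Set.univ MeasurableSet.univ (by simp)
  rw [measure_univ, Set.univ_inter] at h1
  rw [key K hK hcone, mul_right_comm, ← h1, one_mul]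

/-- The Gaussian measure of a subspace, as a measure on the ambient space. -/
noncomputable def gam (X : Submodule ℝ E) : Measure E := (gauss X).map (Subtype.val : X → E)

lemma gam_apply (X : Submodule ℝ E) {S : Set E} (hS : MeasurableSet S) :
    gam X S = gauss X {x : X | (x : E) ∈ S} :=
  Measure.map_apply measurable_subtype_coe hS

instance (X : Submodule ℝ E) : IsProbabilityMeasure (gam X) :=
  Measure.isProbabilityMeasure_map measurable_subtype_coe.aemeasurable

lemma ae_gam_mem (X : Submodule ℝ E) : ∀ᵐ x ∂(gam X), x ∈ X :=
  (ae_map_iff measurable_subtype_coe.aemeasurable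
    X.closed_of_finiteDimensional.measurableSet).2 (.of_forall fun x => x.2)

lemma gam_eq_zero {X Y : Submodule ℝ E} (h : ¬ X ≤ Y) : gam X (Y : Set E) = 0 := by
  rw [gam_apply X Y.closed_of_finiteDimensional.measurableSet]
  refine gauss_absolutelyContinuous (Measure.addHaar_submodule volume (Y.comap X.subtype) ?_)
  rwa [Ne, Submodule.comap_subtype_eq_top]

/-- A Gaussian on X is determined by ‖proj_X t‖². Isometry invariance and the orthogonal splitting
then reduce to identities between norms. -/
lemma charFun_gam (X : Submodule ℝ E) (t : E) :
    charFun (gam X) t = Complex.exp (-(‖X.starProjection t‖ ^ 2 : ℝ) / (4 * Real.pi)) := by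
  have h : charFun (gam X) t = charFun (gauss X) (X.orthogonalProjectionOnto t) := by
    rw [charFun_apply, charFun_apply, gam, integral_map measurable_subtype_coe.aemeasurable
      (by fun_prop)]
    refine integral_congr_ae (.of_forall fun x => ?_)
    simp only
    rw [Submodule.inner_orthogonalProjectionOnto_eq_of_mem_left]
  rw [h, charFun_gauss]
  rfl

lemma gam_top : gam (⊤ : Submodule ℝ E) = gauss E := by
  refine Measure.ext_of_charFun ?_
  ext t
  rw [charFun_gam, charFun_gauss, Submodule.starProjection_eq_self_iff.2 Submodule.mem_top]

lemma gam_map (X : Submodule ℝ E) (g : E ≃ₗᵢ[ℝ] E) :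
    (gam X).map g = gam (X.map (g.toLinearEquiv : E →ₗ[ℝ] E)) := by
  have := Measure.isProbabilityMeasure_map (μ := gam X) g.continuous.measurable.aemeasurable
  refine Measure.ext_of_charFun ?_
  ext t
  have h : charFun ((gam X).map g) t = charFun (gam X) (g.symm t) := by
    rw [charFun_apply, charFun_apply, integral_map g.continuous.measurable.aemeasurable
      (by fun_prop)]
    refine integral_congr_ae (.of_forall fun x => ?_)
    simp only
    rw [g.inner_map_eq_flip]
  rw [h, charFun_gam, charFun_gam, Submodule.starProjection_map_apply]
  simp

lemma gam_conv_gam_orthogonal (X : Submodule ℝ E) : (gam X).conv (gam Xᗮ) = gauss E := by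
  refine Measure.ext_of_charFun ?_
  ext t
  rw [charFun_conv, charFun_gam, charFun_gam, charFun_gauss, ← Complex.exp_add,
    X.norm_sq_eq_add_norm_sq_starProjection t]
  congr 1
  push_cast
  ring

/-- The orthogonal components of a Gaussian vector are independent Gaussian vectors. -/
lemma gauss_orthogonal_components (X : Submodule ℝ E) {A B : Set E} (hA : MeasurableSet A)
    (hB : MeasurableSet B) :
    gauss E {x | X.starProjection x ∈ A ∧ x - X.starProjection x ∈ B} = gam X A * gam Xᗮ B := by
  have hmeas : MeasurableSet {x | X.starProjection x ∈ A ∧ x - X.starProjection x ∈ B} :=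
    (X.starProjection.measurable hA).inter
      ((measurable_id.sub X.starProjection.measurable) hB)
  rw [← gam_conv_gam_orthogonal X, Measure.conv, Measure.map_apply (by fun_prop) hmeas,
    ← Measure.prod_prod]
  refine measure_congr ?_
  have h1 : ∀ᵐ p ∂((gam X).prod (gam Xᗮ)), p.1 ∈ X :=
    Measure.quasiMeasurePreserving_fst.ae (ae_gam_mem X)
  have h2 : ∀ᵐ p ∂((gam X).prod (gam Xᗮ)), p.2 ∈ Xᗮ :=
    Measure.quasiMeasurePreserving_snd.ae (ae_gam_mem Xᗮ)
  filter_upwards [h1, h2] with p hp hq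
  have h3 : X.starProjection (p.1 + p.2) = p.1 := by
    rw [map_add, Submodule.starProjection_eq_self_iff.2 hp,
      X.starProjection_apply_eq_zero_iff.2 hq, add_zero]
  apply propext
  change (X.starProjection (p.1 + p.2) ∈ A ∧ p.1 + p.2 - X.starProjection (p.1 + p.2) ∈ B) ↔
    (p.1 ∈ A ∧ p.2 ∈ B)
  rw [h3, add_sub_cancel_left]

end Gauss

section AngleMeasureGauss

variable {E : Type*} [NormedAddCommGroup E] [InnerProductSpace ℝ E] [FiniteDimensional ℝ E]
  [MeasurableSpace E] [BorelSpace E]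

lemma angleMeasure_eq_gam (K : PointedCone ℝ E) (hK : IsClosed (K : Set E)) :
    angleMeasure K = (gam (linSpan K) (K : Set E)).toReal := by
  have hS : MeasurableSet {x : linSpan K | (x : E) ∈ K} :=
    (hK.preimage continuous_subtype_val).measurableSet
  have h := gauss_mul_volume_closedBall hS (fun x hx r hr => K.smul_mem hr.le hx)
  rw [gam_apply _ hK.measurableSet, angleMeasure, vol_eq_volume, vol_eq_volume, ← h,
    ENNReal.toReal_mul, mul_div_assoc, div_self, mul_one]
  · rfl
  · exact (ENNReal.toReal_pos (Metric.measure_closedBall_pos _ _ one_pos).ne'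
      measure_closedBall_lt_top.ne).ne'

lemma angleMeasure_eq_gauss (K : PointedCone ℝ E) (hK : IsClosed (K : Set E))
    (htop : linSpan K = ⊤) : angleMeasure K = (gauss E (K : Set E)).toReal := by
  rw [angleMeasure_eq_gam K hK, htop, gam_top]

end AngleMeasureGauss

end

end ReflectionCone

/-! ### The two angle identities and the measure of the dual cone. -/

namespace ReflectionCone

section

open scoped InnerProductSpace ENNReal Pointwise

lemma mem_dualCone {E : Type*} [NormedAddCommGroup E] [InnerProductSpace ℝ E]
    [FiniteDimensional ℝ E] {C : PointedCone ℝ E} {v : E} : v ∈ dualCone C ↔ ∀ c ∈ C, 0 ≤ ⟪c, v⟫_ℝ := Iff.rfl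

lemma isClosed_dualCone {E : Type*} [NormedAddCommGroup E] [InnerProductSpace ℝ E]
    [FiniteDimensional ℝ E] (C : PointedCone ℝ E) : IsClosed (dualCone C : Set E) :=
  (ProperCone.innerDual (C : Set E)).isClosed

variable {V : Type*} [NormedAddCommGroup V] [InnerProductSpace ℝ V]

/-- The elements of a finite subgroup as a finite set. -/
noncomputable def elems (W : Subgroup (V ≃ₗᵢ[ℝ] V)) : Finset (V ≃ₗᵢ[ℝ] V) :=
  open scoped Classical in
  if h : (W : Set (V ≃ₗᵢ[ℝ] V)).Finite then h.toFinset else ∅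

lemma mem_elems {W : Subgroup (V ≃ₗᵢ[ℝ] V)} [hW : Finite W] {w : V ≃ₗᵢ[ℝ] V} :
    w ∈ elems W ↔ w ∈ W := by
  have h : (W : Set (V ≃ₗᵢ[ℝ] V)).Finite := Set.toFinite _
  simp [elems, h]

lemma card_elems {W : Subgroup (V ≃ₗᵢ[ℝ] V)} [hW : Finite W] : (elems W).card = Nat.card W := by
  have h : (W : Set (V ≃ₗᵢ[ℝ] V)).Finite := Set.toFinite _
  rw [elems, dif_pos h, ← Set.ncard_eq_toFinset_card _ h]
  rfl

lemma fixedSpace_conj (g w : V ≃ₗᵢ[ℝ] V) :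
    fixedSpace (g * w * g⁻¹) = (fixedSpace w).map (g.toLinearEquiv : V →ₗ[ℝ] V) := by
  ext x
  rw [mem_fixedSpace, Submodule.mem_map]
  constructor
  · intro hx
    refine ⟨g⁻¹ x, mem_fixedSpace.2 ?_, g.apply_symm_apply x⟩
    exact (inv_apply_eq_of_apply_eq (g := g) (x := w (g⁻¹ x)) hx).symm
  · rintro ⟨y, hy, rfl⟩
    change g (w (g⁻¹ (g y))) = g y
    rw [show g⁻¹ (g y) = y from g.symm_apply_apply y, mem_fixedSpace.1 hy]

lemma card_fixer_map {W : Subgroup (V ≃ₗᵢ[ℝ] V)} {g : V ≃ₗᵢ[ℝ] V} (hg : g ∈ W)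
    (X : Submodule ℝ V) :
    Nat.card (fixer W (X.map (g.toLinearEquiv : V →ₗ[ℝ] V))) = Nat.card (fixer W X) := by
  have hset : ((fixer W (X.map (g.toLinearEquiv : V →ₗ[ℝ] V)) : Subgroup _) : Set (V ≃ₗᵢ[ℝ] V)) =
      (fun w => g * w * g⁻¹) '' (fixer W X : Set (V ≃ₗᵢ[ℝ] V)) := by
    ext w
    simp only [Set.mem_image, SetLike.mem_coe, mem_fixer]
    constructor
    · rintro ⟨hw, hX⟩
      refine ⟨g⁻¹ * w * g, ⟨W.mul_mem (W.mul_mem (W.inv_mem hg) hw) hg, fun x hx => ?_⟩, by group⟩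
      have h1 := mem_fixedSpace.1 (hX (Submodule.mem_map_of_mem hx))
      exact mem_fixedSpace.2 (inv_apply_eq_of_apply_eq h1.symm)
    · rintro ⟨w, ⟨hw, hX⟩, rfl⟩
      refine ⟨W.mul_mem (W.mul_mem hg hw) (W.inv_mem hg), ?_⟩
      rw [fixedSpace_conj]
      exact Submodule.map_mono hX
  have h2 := congrArg Set.ncard hset
  rwa [Set.ncard_image_of_injective] at h2
  intro a b hab
  simpa using hab

lemma card_fixer_ne_zero (W : Subgroup (V ≃ₗᵢ[ℝ] V)) [Finite W] (X : Submodule ℝ V) :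
    (Nat.card (fixer W X) : ℝ≥0∞) ≠ 0 := by
  have : Finite (fixer W X) := Finite.Set.subset (W : Set (V ≃ₗᵢ[ℝ] V)) fun w hw => hw.1
  exact_mod_cast Nat.card_pos.ne'

variable [FiniteDimensional ℝ V]

namespace IsDirichlet

variable {W : Subgroup (V ≃ₗᵢ[ℝ] V)} {C : PointedCone ℝ V}

lemma isClosed_of_isFaceOf (h : IsDirichlet W C) {F : PointedCone ℝ V} (hF : F.IsFaceOf C) :
    IsClosed (F : Set V) := by
  rw [h.face_eq hF]
  exact h.isClosed.inter (Submodule.closed_of_finiteDimensional _)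

/-- The finite set of faces of `C`. -/
noncomputable def faceSet (h : IsDirichlet W C) : Finset (PointedCone ℝ V) :=
  h.finite_faces.toFinset

lemma mem_faceSet (h : IsDirichlet W C) {F : PointedCone ℝ V} : F ∈ h.faceSet ↔ F.IsFaceOf C :=
  h.finite_faces.mem_toFinset

/-- The points of the face `F` whose stabilizer fixes `F` pointwise. -/
def core (W : Subgroup (V ≃ₗᵢ[ℝ] V)) (F : PointedCone ℝ V) : Set V :=
  {p | p ∈ F ∧ ∀ w ∈ W, w p = p → w ∈ fixer W (linSpan F)}

/-- The points whose nearest point in `C` is in the core of the face `F`. -/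
def tile (W : Subgroup (V ≃ₗᵢ[ℝ] V)) (C F : PointedCone ℝ V) : Set V :=
  {x | (linSpan F).starProjection x ∈ core W F ∧
    x - (linSpan F).starProjection x ∈ -(dualCone C : Set V)}

/-- With p the point of C nearest to x, the right F is the smallest face containing p. -/
lemma exists_mem_tile (h : IsDirichlet W C) (x : V) : ∃ F, F.IsFaceOf C ∧ x ∈ tile W C F := by
  have hconv : Convex ℝ (C : Set V) := PointedCone.convex C
  obtain ⟨p, hp, hpmin⟩ := exists_norm_eq_iInf_of_complete_convex ⟨0, C.zero_mem⟩
    h.isClosed.isComplete hconv x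
  rw [norm_eq_iInf_iff_real_inner_le_zero hconv hp] at hpmin
  have hp0 : ⟪x - p, p⟫_ℝ = 0 := by
    have h1 := hpmin 0 C.zero_mem
    have h2 := hpmin ((2 : ℝ) • p) (C.smul_mem (by norm_num) hp)
    rw [zero_sub, inner_neg_right] at h1
    rw [two_smul, add_sub_cancel_left] at h2
    linarith
  have hpC : ∀ c ∈ C, ⟪x - p, c⟫_ℝ ≤ 0 := fun c hc => by
    have := hpmin c hc
    rwa [inner_sub_right, hp0, sub_zero] at this
  set F : PointedCone ℝ V := C ⊓ sInf {G | G.IsFaceOf C ∧ p ∈ G} with hFdef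
  have hF : F.IsFaceOf C := PointedCone.IsFaceOf.sInf _ fun G hG => hG.1
  have hmin : ∀ G : PointedCone ℝ V, G.IsFaceOf C → p ∈ G → F ≤ G := fun G hG hpG =>
    inf_le_right.trans (sInf_le ⟨hG, hpG⟩)
  have hpF : p ∈ F := ⟨hp, Submodule.mem_sInf.2 fun G hG => hG.2⟩
  have horth : x - p ∈ (linSpan F)ᗮ := by
    -- The functional ⟪x - p, ·⟫ is nonpositive on C and vanishes at p, so its zero set in C is a
    -- face containing p, hence containing F.
    let G : PointedCone ℝ V := C ⊓ toCone (ℝ ∙ (x - p))ᗮ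
    have hG : G.IsFaceOf C :=
      { le := inf_le_left
        mem_of_smul_add_mem := by
          intro u v a hu hv ha huv
          refine ⟨hu, Submodule.mem_orthogonal_singleton_iff_inner_right.2 ?_⟩
          have h1 : ⟪x - p, a • u + v⟫_ℝ = 0 :=
            Submodule.mem_orthogonal_singleton_iff_inner_right.1 huv.2
          rw [inner_add_right, inner_smul_right] at h1
          have h2 := hpC u hu
          have h3 := hpC v hv
          nlinarith }
    have hFG := hmin G hG ⟨hp, Submodule.mem_orthogonal_singleton_iff_inner_right.2 hp0⟩
    have : linSpan F ≤ (ℝ ∙ (x - p))ᗮ := Submodule.span_le.2 fun y hy => (hFG hy).2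
    rw [← Submodule.span_singleton_le_iff_mem]
    exact (Submodule.le_orthogonal_iff_le_orthogonal).1 this
  have hproj : (linSpan F).starProjection x = p :=
    Submodule.eq_starProjection_of_mem_orthogonal (subset_linSpan F hpF) horth
  refine ⟨F, hF, ?_⟩
  change (linSpan F).starProjection x ∈ core W F ∧
    x - (linSpan F).starProjection x ∈ -(dualCone C : Set V)
  rw [hproj]
  refine ⟨⟨hpF, fun w hw hwp => ⟨hw, Submodule.span_le.2 fun y hy => ?_⟩⟩, ?_⟩
  · exact (hmin _ (h.isFaceOf_inf_fixedSpace hw) ⟨hp, mem_fixedSpace.2 hwp⟩ hy).2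
  · rw [Set.mem_neg]
    exact mem_dualCone.2 fun c hc => by
      rw [inner_neg_right, real_inner_comm]; linarith [hpC c hc]

/-- Both projections satisfy the variational inequality of the nearest point, so they coincide.
Their common stabilizer is the fixer of either face, and the fixer determines the face. -/
lemma tile_unique (h : IsDirichlet W C) {F F' : PointedCone ℝ V} (hF : F.IsFaceOf C)
    (hF' : F'.IsFaceOf C) {x : V} (hx : x ∈ tile W C F) (hx' : x ∈ tile W C F') : F = F' := by
  obtain ⟨⟨hp, hpc⟩, hq⟩ := hx
  obtain ⟨⟨hp', hpc'⟩, hq'⟩ := hx'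
  have ho : ⟪(linSpan F).starProjection x, x - (linSpan F).starProjection x⟫_ℝ = 0 :=
    Submodule.inner_right_of_mem_orthogonal (subset_linSpan F hp)
      ((linSpan F).sub_starProjection_mem_orthogonal x)
  have ho' : ⟪(linSpan F').starProjection x, x - (linSpan F').starProjection x⟫_ℝ = 0 :=
    Submodule.inner_right_of_mem_orthogonal (subset_linSpan F' hp')
      ((linSpan F').sub_starProjection_mem_orthogonal x)
  set p := (linSpan F).starProjection x
  set p' := (linSpan F').starProjection x
  have h1 := mem_dualCone.1 (Set.mem_neg.1 hq) p' (hF'.le hp')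
  have h2 := mem_dualCone.1 (Set.mem_neg.1 hq') p (hF.le hp)
  have hpp : p = p' := by
    have : ⟪p - p', p - p'⟫_ℝ ≤ 0 := by
      simp only [inner_sub_left, inner_sub_right, inner_neg_right] at *
      linarith
    exact sub_eq_zero.1 (inner_self_eq_zero.1 (le_antisymm this real_inner_self_nonneg))
  have hfix : fixer W (linSpan F) = fixer W (linSpan F') := by
    ext w
    constructor
    · intro hw
      exact hpc' w hw.1 (by rw [← hpp]; exact mem_fixedSpace.1 (hw.2 (subset_linSpan F hp)))
    · intro hw
      exact hpc w hw.1 (by rw [hpp]; exact mem_fixedSpace.1 (hw.2 (subset_linSpan F' hp')))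
  rw [h.face_eq hF, h.face_eq hF', hfix]

variable [MeasurableSpace V] [BorelSpace V]

/-- Almost every point of a subspace has the smallest possible stabilizer. -/
lemma ae_gam_generic (hW : Finite W) (X : Submodule ℝ V) :
    ∀ᵐ x ∂(gam X), x ∈ X ∧ ∀ w ∈ W, w x = x → w ∈ fixer W X := by
  refine (ae_gam_mem X).and ?_
  have : ∀ᵐ x ∂(gam X), ∀ w : W, w.1 x = x → w.1 ∈ fixer W X := by
    refine ae_all_iff.2 fun w => ?_
    by_cases hw : X ≤ fixedSpace w.1
    · exact .of_forall fun x _ => ⟨w.2, hw⟩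
    · filter_upwards [measure_eq_zero_iff_ae_notMem.1 (gam_eq_zero hw)] with x hx hwx
      exact absurd (mem_fixedSpace.2 hwx) hx
  filter_upwards [this] with x hx w hw using hx ⟨w, hw⟩

lemma measurableSet_core (h : IsDirichlet W C) {F : PointedCone ℝ V} (hF : F.IsFaceOf C) :
    MeasurableSet (core W F) := by
  have := h.finite
  have heq : core W F = (F : Set V) ∩
      ⋂ w : W, {p | w.1 p = p → w.1 ∈ fixer W (linSpan F)} := by
    ext p; simp [core]
  rw [heq]
  refine (h.isClosed_of_isFaceOf hF).measurableSet.inter (.iInter fun w => ?_)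
  by_cases hw : w.1 ∈ fixer W (linSpan F)
  · simp [hw]
  · simp only [hw, imp_false]
    exact (measurableSet_eq_fun w.1.continuous.measurable measurable_id).compl

lemma gauss_tile (h : IsDirichlet W C) {F : PointedCone ℝ V} (hF : F.IsFaceOf C) :
    gauss V (tile W C F) =
      gam (linSpan F) (F : Set V) * gam (linSpan F)ᗮ (dualCone C : Set V) := by
  have hdual : MeasurableSet (dualCone C : Set V) := (isClosed_dualCone C).measurableSet
  rw [tile, gauss_orthogonal_components _ (h.measurableSet_core hF) hdual.neg]
  congr 1
  · refine measure_congr ?_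
    filter_upwards [ae_gam_generic h.finite (linSpan F)] with x hx
    exact propext ⟨fun hc => hc.1, fun hc => ⟨hc, hx.2⟩⟩
  · have h1 := gam_map (linSpan F)ᗮ (LinearIsometryEquiv.neg ℝ)
    have h2 : (linSpan F)ᗮ.map ((LinearIsometryEquiv.neg ℝ (E := V)).toLinearEquiv : V →ₗ[ℝ] V) =
        (linSpan F)ᗮ := by
      ext x
      rw [Submodule.mem_map]
      exact ⟨by rintro ⟨y, hy, rfl⟩; exact Submodule.neg_mem _ hy,
        fun hx => ⟨-x, Submodule.neg_mem _ hx, neg_neg x⟩⟩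
    rw [h2] at h1
    conv_rhs => rw [← h1]
    rw [Measure.map_apply (LinearIsometryEquiv.continuous _).measurable hdual]
    rfl

lemma measurableSet_tile (h : IsDirichlet W C) {F : PointedCone ℝ V} (hF : F.IsFaceOf C) :
    MeasurableSet (tile W C F) :=
  ((linSpan F).starProjection.measurable (h.measurableSet_core hF)).inter
    ((measurable_id.sub (linSpan F).starProjection.measurable)
      (isClosed_dualCone C).measurableSet.neg)

/-- The products of the angles of the faces and of their dual cones add up to one. -/
lemma sum_gam_mul_gam_dualCone (h : IsDirichlet W C) :
    ∑ F ∈ h.faceSet, gam (linSpan F) (F : Set V) * gam (linSpan F)ᗮ (dualCone C : Set V) = 1 := by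
  have hcov : (⋃ F ∈ h.faceSet, tile W C F) = Set.univ := by
    refine Set.eq_univ_of_forall fun x => ?_
    obtain ⟨F, hF, hx⟩ := h.exists_mem_tile x
    exact Set.mem_iUnion₂.2 ⟨F, h.mem_faceSet.2 hF, hx⟩
  have hdisj : (h.faceSet : Set (PointedCone ℝ V)).PairwiseDisjoint (tile W C) := by
    intro F hF F' hF' hne
    refine Set.disjoint_left.2 fun x hx hx' => hne ?_
    exact h.tile_unique (h.mem_faceSet.1 hF) (h.mem_faceSet.1 hF') hx hx'
  have := measure_biUnion_finset (μ := gauss V) hdisj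
    fun F hF => h.measurableSet_tile (h.mem_faceSet.1 hF)
  rw [hcov, measure_univ] at this
  rw [this]
  exact Finset.sum_congr rfl fun F hF => (h.gauss_tile (h.mem_faceSet.1 hF)).symm

/-- The translates of `C` cover almost every point of the subspace `X` as often as there are
elements of `W` fixing `X` pointwise. -/
lemma sum_gam_preimage (h : IsDirichlet W C) (X : Submodule ℝ V) :
    ∑ g ∈ elems W, gam X (g ⁻¹' (C : Set V)) = Nat.card (fixer W X) := by
  classical
  have hfin := h.finite
  have hmeas : ∀ g : V ≃ₗᵢ[ℝ] V, MeasurableSet (g ⁻¹' (C : Set V)) := fun g =>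
    g.continuous.measurable h.isClosed.measurableSet
  have h1 : ∀ g : V ≃ₗᵢ[ℝ] V, gam X (g ⁻¹' (C : Set V)) =
      ∫⁻ x, (g ⁻¹' (C : Set V)).indicator 1 x ∂(gam X) := fun g =>
    (lintegral_indicator_one (hmeas g)).symm
  simp_rw [h1]
  rw [← lintegral_finsetSum _ fun g _ => measurable_one.indicator (hmeas g)]
  have h2 : ∀ᵐ x ∂(gam X), ∑ g ∈ elems W, (g ⁻¹' (C : Set V)).indicator (1 : V → ℝ≥0∞) x =
      Nat.card (fixer W X) := by
    filter_upwards [ae_gam_generic h.finite X] with x hx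
    obtain ⟨g₀, hg₀, hgC⟩ := h.cover x
    -- Since C meets the orbit of x once, these g form a coset of the stabilizer of x, which for
    -- generic x is the fixer of X.
    have hset : {g : V ≃ₗᵢ[ℝ] V | g ∈ W ∧ g x ∈ C} =
        (fun w => g₀ * w) '' (fixer W X : Set (V ≃ₗᵢ[ℝ] V)) := by
      ext g
      simp only [Set.mem_ofPred_eq, Set.mem_image, SetLike.mem_coe]
      constructor
      · rintro ⟨hg, hgx⟩
        refine ⟨g₀⁻¹ * g, hx.2 _ (W.mul_mem (W.inv_mem hg₀) hg) ?_, by group⟩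
        refine inv_apply_eq_of_apply_eq (y := g x) ?_
        have h3 : (g₀ * g⁻¹) (g x) = g₀ x := by
          change g₀ (g⁻¹ (g x)) = g₀ x
          rw [show g⁻¹ (g x) = x from g.symm_apply_apply x]
        rw [← h3]
        exact h.fixed_of_mem (W.mul_mem hg₀ (W.inv_mem hg)) hgx (h3 ▸ hgC)
      · rintro ⟨w, hw, rfl⟩
        refine ⟨W.mul_mem hg₀ hw.1, ?_⟩
        change g₀ (w x) ∈ C
        rwa [mem_fixedSpace.1 (hw.2 hx.1)]
    have hcard := congrArg Set.ncard hset
    rw [Set.ncard_image_of_injective _ (mul_right_injective g₀)] at hcard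
    have h4 : ((elems W).filter fun g => g x ∈ C).card = Nat.card (fixer W X) := by
      rw [← Set.ncard_coe_finset]
      refine Eq.trans (congrArg Set.ncard ?_) hcard
      ext g
      simp [mem_elems]
    rw [← h4, Finset.card_filter]
    push_cast
    refine Finset.sum_congr rfl fun g _ => ?_
    simp [Set.indicator_apply]
  rw [lintegral_congr_ae h2, lintegral_const, measure_univ, mul_one]

/-- Write each 1 in |A| as a normalized sum over g of the measures of g⁻¹C in Fix w, and exchange
the sums. Replacing w by g w g⁻¹ moves g⁻¹C to C, so every g contributes equally. -/
lemma card_eq_mul_sum_gam (h : IsDirichlet W C) {A : Finset (V ≃ₗᵢ[ℝ] V)}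
    (hconj : ∀ g ∈ W, ∀ w ∈ A, g * w * g⁻¹ ∈ A) :
    (A.card : ℝ≥0∞) = Nat.card W *
      ∑ w ∈ A, gam (fixedSpace w) (C : Set V) / Nat.card (fixer W (fixedSpace w)) := by
  have hfin := h.finite
  have h1 : ∀ w ∈ A, (1 : ℝ≥0∞) = ∑ g ∈ elems W,
      gam (fixedSpace w) (g ⁻¹' (C : Set V)) / Nat.card (fixer W (fixedSpace w)) := by
    intro w hw
    simp_rw [div_eq_mul_inv]
    rw [← Finset.sum_mul, h.sum_gam_preimage, ENNReal.mul_inv_cancel (card_fixer_ne_zero W _)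
      (ENNReal.natCast_ne_top _)]
  rw [Finset.card_eq_sum_ones, Nat.cast_sum]
  simp_rw [Nat.cast_one]
  rw [Finset.sum_congr rfl h1, Finset.sum_comm, ← card_elems, ← nsmul_eq_mul]
  refine Finset.sum_eq_card_nsmul fun g hg => ?_
  have hg := mem_elems.1 hg
  refine Finset.sum_bij' (fun w _ => g * w * g⁻¹) (fun w _ => g⁻¹ * w * g)
    (fun w hw => hconj g hg w hw) (fun w hw => ?_) (fun w _ => by group) (fun w _ => by group) ?_
  · simpa using hconj g⁻¹ (W.inv_mem hg) w hw
  · intro w hw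
    rw [fixedSpace_conj, card_fixer_map hg, ← gam_map,
      Measure.map_apply g.continuous.measurable h.isClosed.measurableSet]

lemma gam_linSpan_face {F : PointedCone ℝ V} (hF : F.IsFaceOf C) :
    gam (linSpan F) (C : Set V) = gam (linSpan F) (F : Set V) := by
  refine measure_congr ?_
  filter_upwards [ae_gam_mem (linSpan F)] with x hx
  exact propext ⟨fun hc => inter_linSpan_of_isFaceOf hF hc hx, fun hc => hF.le hc⟩

/-- If C ∩ Fix w does not span Fix w, it is a null set there; otherwise it is the only face with
span Fix w. -/
lemma sum_fixedSpace_eq_sum_faces (h : IsDirichlet W C) {A : Finset (V ≃ₗᵢ[ℝ] V)}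
    (hA : ∀ w ∈ A, w ∈ W) [DecidableEq (Submodule ℝ V)] :
    ∑ w ∈ A, gam (fixedSpace w) (C : Set V) / Nat.card (fixer W (fixedSpace w)) =
      ∑ F ∈ h.faceSet, gam (linSpan F) (F : Set V) *
        ((A.filter fun w => fixedSpace w = linSpan F).card / Nat.card (fixer W (linSpan F))) := by
  have h1 : ∀ F ∈ h.faceSet, gam (linSpan F) (F : Set V) *
      ((A.filter fun w => fixedSpace w = linSpan F).card / Nat.card (fixer W (linSpan F))) =
      ∑ w ∈ A, if fixedSpace w = linSpan F then
        gam (fixedSpace w) (C : Set V) / Nat.card (fixer W (fixedSpace w)) else 0 := by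
    intro F hF
    rw [← Finset.sum_filter, ← gam_linSpan_face (h.mem_faceSet.1 hF)]
    rw [Finset.sum_eq_card_nsmul (b := gam (linSpan F) (C : Set V) /
      Nat.card (fixer W (linSpan F)))]
    · rw [nsmul_eq_mul, div_eq_mul_inv, div_eq_mul_inv, mul_left_comm]
    · intro w hw
      rw [(Finset.mem_filter.1 hw).2]
  rw [Finset.sum_congr rfl h1, Finset.sum_comm]
  refine Finset.sum_congr rfl fun w hw => ?_
  by_cases h0 : gam (fixedSpace w) (C : Set V) = 0
  · simp [h0]
  have hface := h.isFaceOf_inf_fixedSpace (hA w hw)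
  have hspan : linSpan (C ⊓ toCone (fixedSpace w)) = fixedSpace w := by
    refine le_antisymm (Submodule.span_le.2 fun x hx => hx.2) ?_
    by_contra hle
    refine h0 (measure_mono_null_ae ?_ (gam_eq_zero hle))
    filter_upwards [ae_gam_mem (fixedSpace w)] with x hx hxC
    exact subset_linSpan (C ⊓ toCone (fixedSpace w)) ⟨hxC, hx⟩
  rw [Finset.sum_eq_single (C ⊓ toCone (fixedSpace w)), if_pos hspan.symm]
  · intro F hF hne
    refine if_neg fun heq => hne ?_
    ext x
    rw [heq]
    exact ⟨fun hx => ⟨(h.mem_faceSet.1 hF).le hx, subset_linSpan F hx⟩,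
      fun hx => inter_linSpan_of_isFaceOf (h.mem_faceSet.1 hF) hx.1 hx.2⟩
  · intro hn
    exact absurd (h.mem_faceSet.2 hface) hn

open scoped Classical in
-- On ⟨F⟩ᗮ the duals of C and C + ⟨F⟩ agree, and any w with Fix w = ⟨F⟩ already lies in the fixer.
-- The formula for the localized pair is a hypothesis so that it can come from the induction
-- hypothesis or from `gam_dualCone`.
lemma gam_dualCone_face_of_localize (h : IsDirichlet W C) {F : PointedCone ℝ V}
    (hF : F.IsFaceOf C)
    (hd : gam (commonFixed (fixer W (linSpan F)))ᗮ (dualCone (C ⊔ toCone (linSpan F)) : Set V) =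
      ((elems (fixer W (linSpan F))).filter
        fun w => fixedSpace w = commonFixed (fixer W (linSpan F))).card /
          Nat.card (fixer W (linSpan F))) :
    gam (linSpan F)ᗮ (dualCone C : Set V) =
      ((elems W).filter fun w => fixedSpace w = linSpan F).card /
        Nat.card (fixer W (linSpan F)) := by
  have hfin := h.finite
  have hlocfin := (h.localize hF).finite
  rw [h.commonFixed_fixer_linSpan hF] at hd
  convert hd using 1
  · refine measure_congr ?_
    filter_upwards [ae_gam_mem (linSpan F)ᗮ] with x hx
    refine propext ⟨fun hd => mem_dualCone.2 fun c hc => ?_, fun hd => mem_dualCone.2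
      fun c hc => mem_dualCone.1 hd c (Submodule.mem_sup_left hc)⟩
    obtain ⟨a, ha, f, hf, rfl⟩ := Submodule.mem_sup.1 hc
    rw [inner_add_left, Submodule.inner_right_of_mem_orthogonal hf hx, add_zero]
    exact mem_dualCone.1 hd a ha
  · congr 3
    ext w
    simp only [Finset.mem_filter, mem_elems, mem_fixer]
    exact ⟨fun hw => ⟨⟨hw.1, hw.2.ge⟩, hw.2⟩, fun hw => ⟨hw.1.1, hw.2⟩⟩

open scoped Classical in
/-- The dual cone of `C` occupies in its span the proportion of elements of `W` whose fixed space
is as small as possible. -/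
lemma gam_dualCone (h : IsDirichlet W C) :
    gam (commonFixed W)ᗮ (dualCone C : Set V) =
      ((elems W).filter fun w => fixedSpace w = commonFixed W).card / Nat.card W := by
  induction hn : Nat.card W using Nat.strong_induction_on generalizing W C with
  | _ n ih =>
    subst hn
    have hfin := h.finite
    have hWpos : (Nat.card W : ℝ≥0∞) ≠ 0 := by exact_mod_cast Nat.card_pos.ne'
    set F₀ : PointedCone ℝ V := C ⊓ toCone (commonFixed W) with hF₀
    have hface := h.isFaceOf_inf_commonFixed le_rfl
    have hcoe : (F₀ : Set V) = commonFixed W := by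
      ext x
      exact ⟨fun hx => hx.2, fun hx => ⟨h.commonFixed_le hx, hx⟩⟩
    have hspan : linSpan F₀ = commonFixed W := by
      rw [linSpan, hcoe, Submodule.span_eq]
    have hfixer : fixer W (commonFixed W) = W := by
      ext w
      exact ⟨fun hw => hw.1, fun hw => ⟨hw, fun x hx =>
        mem_fixedSpace.2 (mem_commonFixed.1 hx w hw)⟩⟩
    have hone : gam (linSpan F₀) (F₀ : Set V) = 1 := by
      rw [hcoe, hspan]
      exact (mem_ae_iff_prob_eq_one (Submodule.closed_of_finiteDimensional _).measurableSet).1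
        (ae_gam_mem (commonFixed W))
    have hsum1 := h.sum_gam_mul_gam_dualCone
    have hsum2 := h.card_eq_mul_sum_gam (A := elems W) (fun g hg w hw =>
      mem_elems.2 (W.mul_mem (W.mul_mem hg (mem_elems.1 hw)) (W.inv_mem hg)))
    rw [h.sum_fixedSpace_eq_sum_faces (fun w hw => mem_elems.1 hw), card_elems] at hsum2
    have hsum3 : ∑ F ∈ h.faceSet, gam (linSpan F) (F : Set V) *
        (((elems W).filter fun w => fixedSpace w = linSpan F).card /
          Nat.card (fixer W (linSpan F))) = 1 := by
      rw [← ENNReal.mul_right_inj hWpos (ENNReal.natCast_ne_top _), ← hsum2, mul_one]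
    have hother : ∀ F ∈ h.faceSet.erase F₀, gam (linSpan F)ᗮ (dualCone C : Set V) =
        ((elems W).filter fun w => fixedSpace w = linSpan F).card /
          Nat.card (fixer W (linSpan F)) := by
      intro F hF
      obtain ⟨hne, hF⟩ := Finset.mem_erase.1 hF
      have hF := h.mem_faceSet.1 hF
      -- A face fixed by all of W is C ∩ V^W = F₀, so every other face has a proper fixer and
      -- induction applies.
      have hlt : Nat.card (fixer W (linSpan F)) < Nat.card W := by
        refine lt_of_le_of_ne ?_ fun heq => hne ?_
        · exact Nat.card_mono (Set.toFinite (W : Set (V ≃ₗᵢ[ℝ] V))) fun w hw => hw.1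
        · have : fixer W (linSpan F) = W := by
            apply SetLike.coe_injective
            exact Set.eq_of_subset_of_ncard_le (fun w hw => hw.1) heq.ge
              (Set.toFinite (W : Set (V ≃ₗᵢ[ℝ] V)))
          rw [h.face_eq hF, this]
      exact h.gam_dualCone_face_of_localize hF (ih _ hlt (h.localize hF) rfl)
    have hmem : F₀ ∈ h.faceSet := h.mem_faceSet.2 hface
    rw [← Finset.add_sum_erase _ _ hmem] at hsum1 hsum3
    rw [Finset.sum_congr rfl fun F hF => by rw [hother F hF]] at hsum1
    have hne : ∑ F ∈ h.faceSet.erase F₀, gam (linSpan F) (F : Set V) *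
        (((elems W).filter fun w => fixedSpace w = linSpan F).card /
          Nat.card (fixer W (linSpan F)) : ℝ≥0∞) ≠ ∞ :=
      ne_top_of_le_ne_top ENNReal.one_ne_top (hsum3 ▸ le_add_self)
    have hfinal := (ENNReal.add_left_inj hne).1 (hsum1.trans hsum3.symm)
    rwa [hone, one_mul, one_mul, hspan, hfixer] at hfinal

end IsDirichlet

end

end ReflectionCone

/-! ### Angle measures of faces and quotient duals; the sum over k-faces. -/

namespace ReflectionCone

section

open scoped InnerProductSpace ENNReal Pointwise

variable {V : Type*} [NormedAddCommGroup V] [InnerProductSpace ℝ V] [FiniteDimensional ℝ V]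

lemma mem_dualCone_coneQuot {C F : PointedCone ℝ V} {v : (linSpan F)ᗮ} :
    v ∈ dualCone (coneQuot C F) ↔ (v : V) ∈ dualCone C := by
  rw [mem_dualCone, mem_dualCone]
  have key : ∀ c : V, ⟪(linSpan F)ᗮ.orthogonalProjectionOnto c, v⟫_ℝ = ⟪c, (v : V)⟫_ℝ := fun c =>
    Submodule.inner_orthogonalProjectionOnto_eq_of_mem_right v c
  constructor
  · intro h c hc
    rw [← key]
    exact h _ ⟨c, hc, rfl⟩
  · rintro h _ ⟨c, hc, rfl⟩
    exact (h c hc).trans_eq (key c).symm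

namespace IsDirichlet

variable {W : Subgroup (V ≃ₗᵢ[ℝ] V)} {C : PointedCone ℝ V}

/-- Needed so that the relative angle of (C/F)* is measured in all of ⟨F⟩ᗮ. The dual contains c₀ - w
c₀ for w in the fixer; a vector orthogonal to all of these is fixed by the fixer, so it lies in ⟨F⟩
∩ ⟨F⟩ᗮ = 0. -/
lemma linSpan_dualCone_coneQuot (h : IsDirichlet W C) {F : PointedCone ℝ V} (hF : F.IsFaceOf C) :
    linSpan (dualCone (coneQuot C F)) = ⊤ := by
  rw [← Submodule.orthogonal_eq_bot_iff, Submodule.eq_bot_iff]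
  intro y hy
  have hloc := h.localize hF
  obtain ⟨c₀, hc₀, hsep⟩ := hloc.exists_separating
  have horth : ∀ w ∈ fixer W (linSpan F), ⟪(y : V), c₀ - w c₀⟫_ℝ = 0 := by
    intro w hw
    have h1 : c₀ - w c₀ ∈ (linSpan F)ᗮ := by
      rw [Submodule.mem_orthogonal]
      intro x hx
      have h2 : w⁻¹ x = x := inv_apply_eq_of_apply_eq (mem_fixedSpace.1 (hw.2 hx))
      rw [inner_sub_right, ← inner_inv_apply w, h2, sub_self]
    have h2 : (⟨_, h1⟩ : (linSpan F)ᗮ) ∈ dualCone (coneQuot C F) := by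
      rw [mem_dualCone_coneQuot, mem_dualCone]
      intro c hc
      exact (hloc.mem_iff hc₀ hsep).1 (Submodule.mem_sup_left hc) w hw
    exact (Submodule.mem_orthogonal' _ _).1 hy _ (subset_linSpan _ h2)
  have hyC : (y : V) ∈ C ⊔ toCone (linSpan F) :=
    (hloc.mem_iff hc₀ hsep).2 fun w hw => (horth w hw).ge
  have hfix : (y : V) ∈ commonFixed (fixer W (linSpan F)) := mem_commonFixed.2 fun w hw => by
    refine hsep w hw _ hyC ?_
    have := horth w⁻¹ (inv_mem hw)
    rwa [inner_sub_right, ← inner_inv_apply, inv_inv, ← inner_sub_left] at this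
  rw [h.commonFixed_fixer_linSpan hF] at hfix
  exact Subtype.ext (inner_self_eq_zero.1 (Submodule.inner_right_of_mem_orthogonal hfix y.2))

lemma faces_finite (h : IsDirichlet W C) (k : ℕ) : (faces C k).Finite :=
  h.finite_faces.subset fun _ hF => hF.1

open scoped Classical in
lemma gam_dualCone_face [MeasurableSpace V] [BorelSpace V] (h : IsDirichlet W C)
    {F : PointedCone ℝ V} (hF : F.IsFaceOf C) :
    gam (linSpan F)ᗮ (dualCone C : Set V) =
      ((elems W).filter fun w => fixedSpace w = linSpan F).card /
        Nat.card (fixer W (linSpan F)) :=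
  h.gam_dualCone_face_of_localize hF (h.localize hF).gam_dualCone

lemma angleMeasure_dualCone_coneQuot [MeasurableSpace V] [BorelSpace V] (h : IsDirichlet W C)
    {F : PointedCone ℝ V} (hF : F.IsFaceOf C) :
    angleMeasure (dualCone (coneQuot C F)) = (gam (linSpan F)ᗮ (dualCone C : Set V)).toReal := by
  rw [angleMeasure_eq_gauss _ (isClosed_dualCone _) (h.linSpan_dualCone_coneQuot hF),
    gam_apply _ (isClosed_dualCone C).measurableSet]
  congr 2
  ext v
  exact mem_dualCone_coneQuot

theorem sum_angleMeasure_faces (h : IsDirichlet W C) (k : ℕ) :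
    ∑ᶠ F ∈ faces C k, angleMeasure F * angleMeasure (dualCone (coneQuot C F)) =
      ((fixedDim W k).ncard : ℝ) / (Nat.card W : ℝ) := by
  classical
  borelize V
  have hfin := h.finite
  set A : Finset (V ≃ₗᵢ[ℝ] V) := (elems W).filter fun w => finrank ℝ (fixedSpace w) = k with hA
  have hAcard : (fixedDim W k).ncard = A.card := by
    rw [← Set.ncard_coe_finset]
    congr 1
    ext w
    simp only [hA, Finset.coe_filter, mem_elems]
    rfl
  have hconj : ∀ g ∈ W, ∀ w ∈ A, g * w * g⁻¹ ∈ A := by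
    intro g hg w hw
    obtain ⟨hw, hk⟩ := Finset.mem_filter.1 hw
    refine Finset.mem_filter.2
      ⟨mem_elems.2 (W.mul_mem (W.mul_mem hg (mem_elems.1 hw)) (W.inv_mem hg)), ?_⟩
    rw [fixedSpace_conj, ← hk]
    exact LinearEquiv.finrank_map_eq g.toLinearEquiv _
  have hmain := h.card_eq_mul_sum_gam hconj
  rw [h.sum_fixedSpace_eq_sum_faces fun w hw => mem_elems.1 (Finset.mem_filter.1 hw).1] at hmain
  have hterm : ∀ F ∈ h.faceSet, gam (linSpan F) (F : Set V) *
      ((A.filter fun w => fixedSpace w = linSpan F).card / Nat.card (fixer W (linSpan F))) =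
      if dim F = k then gam (linSpan F) (F : Set V) * gam (linSpan F)ᗮ (dualCone C : Set V)
        else 0 := by
    intro F hF
    split_ifs with hk
    · rw [h.gam_dualCone_face (h.mem_faceSet.1 hF)]
      congr 4
      ext w
      simp only [hA, Finset.mem_filter]
      exact ⟨fun hw => ⟨hw.1.1, hw.2⟩, fun hw => ⟨⟨hw.1, by rw [hw.2]; exact hk⟩, hw.2⟩⟩
    · rw [Finset.filter_eq_empty_iff.2, Finset.card_empty, Nat.cast_zero, ENNReal.zero_div,
        mul_zero]
      intro w hw heq
      have := (Finset.mem_filter.1 hw).2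
      rw [heq] at this
      exact hk this
  rw [Finset.sum_congr rfl hterm, ← Finset.sum_filter] at hmain
  have hfaces : ∑ᶠ F ∈ faces C k, angleMeasure F * angleMeasure (dualCone (coneQuot C F)) =
      ∑ F ∈ h.faceSet with dim F = k,
        angleMeasure F * angleMeasure (dualCone (coneQuot C F)) := by
    rw [← finsum_mem_coe_finset]
    congr 1
    ext F
    simp [faces, h.mem_faceSet]
  rw [hfaces, hAcard, eq_div_iff (by exact_mod_cast Nat.card_pos.ne'), mul_comm]
  have hreal := congrArg ENNReal.toReal hmain
  rw [ENNReal.toReal_natCast, ENNReal.toReal_mul, ENNReal.toReal_natCast,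
    ENNReal.toReal_sum fun F _ => ENNReal.mul_ne_top (measure_ne_top _ _) (measure_ne_top _ _)]
    at hreal
  rw [hreal]
  congr 1
  refine Finset.sum_congr rfl fun F hF => ?_
  have hF := h.mem_faceSet.1 (Finset.mem_filter.1 hF).1
  rw [ENNReal.toReal_mul, angleMeasure_eq_gam F (h.isClosed_of_isFaceOf hF),
    h.angleMeasure_dualCone_coneQuot hF]

end IsDirichlet

end

end ReflectionCone

/-! ### Roots and chambers: a fundamental cone is a Dirichlet domain. -/

namespace ReflectionCone

section

open scoped InnerProductSpace

variable {V : Type*} [NormedAddCommGroup V] [InnerProductSpace ℝ V]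

/-- The orthogonal reflection in the hyperplane perpendicular to `v`. -/
noncomputable def refl (v : V) : V ≃ₗᵢ[ℝ] V := (ℝ ∙ v)ᗮ.reflection

lemma refl_apply {v : V} (hv : ‖v‖ = 1) (x : V) : refl v x = x - (2 * ⟪v, x⟫_ℝ) • v := by
  rw [refl, Submodule.reflection_orthogonal_apply, Submodule.reflection_singleton_apply, hv]
  simp only [RCLike.ofReal_real_eq_id, id_eq, one_pow, div_one]
  module

lemma refl_self (v : V) : refl v v = -v := by
  rw [refl, Submodule.reflection_orthogonal_apply,
    Submodule.reflection_mem_subspace_eq_self (Submodule.mem_span_singleton_self v)]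

lemma refl_mul_self (v : V) : refl v * refl v = 1 := Submodule.reflection_mul_reflection _

lemma refl_inv (v : V) : (refl v)⁻¹ = refl v := inv_eq_of_mul_eq_one_left (refl_mul_self v)

lemma refl_smul {r : ℝ} (hr : r ≠ 0) (v : V) : refl (r • v) = refl v := by
  simp only [refl]
  congr 2
  exact Submodule.span_singleton_smul_eq (IsUnit.mk0 r hr) v

lemma refl_map (g : V ≃ₗᵢ[ℝ] V) {v : V} (hv : ‖v‖ = 1) : refl (g v) = g * refl v * g⁻¹ := by
  ext x
  change _ = g (refl v (g⁻¹ x))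
  rw [refl_apply (by simpa using hv), refl_apply hv, map_sub, map_smul,
    real_inner_comm (g⁻¹ x) v, inner_inv_apply, real_inner_comm (g v) x,
    show g (g⁻¹ x) = x from g.apply_symm_apply x]

/-- The unit vectors perpendicular to the reflection hyperplanes of `W`. -/
def roots (W : Subgroup (V ≃ₗᵢ[ℝ] V)) : Set V := {v | ‖v‖ = 1 ∧ refl v ∈ W}

/-- The roots on the same side as `x₀`. -/
def posRoots (W : Subgroup (V ≃ₗᵢ[ℝ] V)) (x₀ : V) : Set V := {v | v ∈ roots W ∧ 0 < ⟪v, x₀⟫_ℝ}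

/-- The positive roots whose reflection permutes the other positive roots. -/
def simpleRoots (W : Subgroup (V ≃ₗᵢ[ℝ] V)) (x₀ : V) : Set V :=
  {a | a ∈ posRoots W x₀ ∧ ∀ b ∈ posRoots W x₀, b ≠ a → refl a b ∈ posRoots W x₀}

/-- The closed chamber containing `x₀`. -/
def chamber (W : Subgroup (V ≃ₗᵢ[ℝ] V)) (x₀ : V) : Set V := {y | ∀ v ∈ posRoots W x₀, 0 ≤ ⟪v, y⟫_ℝ}

/-- The open chamber containing `x₀`. -/
def openChamber (W : Subgroup (V ≃ₗᵢ[ℝ] V)) (x₀ : V) : Set V :=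
  {y | ∀ v ∈ posRoots W x₀, 0 < ⟪v, y⟫_ℝ}

variable {W : Subgroup (V ≃ₗᵢ[ℝ] V)} {x₀ : V}

lemma map_mem_roots {g : V ≃ₗᵢ[ℝ] V} (hg : g ∈ W) {v : V} (hv : v ∈ roots W) : g v ∈ roots W := by
  refine ⟨by simpa using hv.1, ?_⟩
  rw [refl_map g hv.1]
  exact W.mul_mem (W.mul_mem hg hv.2) (W.inv_mem hg)

lemma neg_mem_roots {v : V} (hv : v ∈ roots W) : -v ∈ roots W := by
  refine ⟨by simpa using hv.1, ?_⟩
  rw [← neg_one_smul ℝ v, refl_smul (by norm_num)]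
  exact hv.2

lemma ne_zero_of_mem_roots {v : V} (hv : v ∈ roots W) : v ≠ 0 := fun h => by
  have := hv.1
  simp [h] at this

lemma inner_ne_zero_of_regular [FiniteDimensional ℝ V] (hx₀ : x₀ ∈ regularPoints W) {v : V} (hv : v ∈ roots W) :
    ⟪v, x₀⟫_ℝ ≠ 0 := fun h =>
  hx₀ v (ne_zero_of_mem_roots hv) hv.2 (Submodule.mem_orthogonal_singleton_iff_inner_right.2 h)

lemma neg_mem_posRoots [FiniteDimensional ℝ V] (hx₀ : x₀ ∈ regularPoints W) {v : V} (hv : v ∈ roots W)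
    (h : v ∉ posRoots W x₀) : -v ∈ posRoots W x₀ := by
  refine ⟨neg_mem_roots hv, ?_⟩
  have h1 := inner_ne_zero_of_regular hx₀ hv
  have h2 : ¬ 0 < ⟪v, x₀⟫_ℝ := fun hp => h ⟨hv, hp⟩
  rw [inner_neg_left]
  exact neg_pos.2 (lt_of_le_of_ne (not_lt.1 h2) h1)

lemma finite_posRoots [Finite W] : (posRoots W x₀).Finite := by
  have hW : (W : Set (V ≃ₗᵢ[ℝ] V)).Finite := Set.toFinite _
  refine Set.Finite.of_finite_image (f := refl) (hW.subset ?_) ?_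
  · rintro _ ⟨v, hv, rfl⟩
    exact hv.1.2
  · intro u hu v hv huv
    have h1 : refl u u = refl v u := by rw [huv]
    rw [refl_self, refl_apply hv.1.1] at h1
    have h2 : u = ⟪v, u⟫_ℝ • v := by
      have h3 : (2 : ℝ) • u = (2 : ℝ) • (⟪v, u⟫_ℝ • v) := by
        linear_combination (norm := module) -h1
      exact smul_right_injective V (two_ne_zero (α := ℝ)) h3
    have hpos : 0 < ⟪v, u⟫_ℝ := by
      have h4 := hu.2
      rw [h2, inner_smul_left] at h4
      exact pos_of_mul_pos_left h4 hv.2.le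
    have hnorm := congrArg norm h2
    rw [norm_smul, hu.1.1, hv.1.1, mul_one, Real.norm_eq_abs, abs_of_pos hpos] at hnorm
    rw [h2, ← hnorm, one_smul]

/-- Every positive root has positive inner product with some simple root. -/
lemma exists_simple_inner_pos [FiniteDimensional ℝ V] [Finite W] (hx₀ : x₀ ∈ regularPoints W) {γ : V}
    (hγ : γ ∈ posRoots W x₀) : ∃ a ∈ simpleRoots W x₀, 0 < ⟪a, γ⟫_ℝ := by
  have hγγ : 0 < ⟪γ, γ⟫_ℝ := real_inner_self_pos.2 (ne_zero_of_mem_roots hγ.1)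
  have hfin : {δ | δ ∈ posRoots W x₀ ∧ 0 < ⟪δ, γ⟫_ℝ}.Finite :=
    finite_posRoots.subset fun δ hδ => hδ.1
  -- Slide from x₀ in direction -γ: x₀ - m γ is the first point on a root hyperplane. Among the
  -- positive roots vanishing there, the one of least height ⟪·, x₀⟫ will be simple.
  obtain ⟨δ, ⟨hδ, hδγ⟩, hmin⟩ := Set.exists_min_image _ (fun δ => ⟪δ, x₀⟫_ℝ / ⟪δ, γ⟫_ℝ) hfin
    ⟨γ, hγ, hγγ⟩
  set m := ⟪δ, x₀⟫_ℝ / ⟪δ, γ⟫_ℝ with hm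
  have hmpos : 0 < m := div_pos hδ.2 hδγ
  have hle : ∀ b ∈ posRoots W x₀, m * ⟪b, γ⟫_ℝ ≤ ⟪b, x₀⟫_ℝ := by
    intro b hb
    rcases le_or_gt ⟪b, γ⟫_ℝ 0 with h0 | h0
    · exact (mul_nonpos_of_nonneg_of_nonpos hmpos.le h0).trans hb.2.le
    · exact (le_div_iff₀ h0).1 (hmin b ⟨hb, h0⟩)
  have hfin2 : {b | b ∈ posRoots W x₀ ∧ m * ⟪b, γ⟫_ℝ = ⟪b, x₀⟫_ℝ}.Finite :=
    finite_posRoots.subset fun b hb => hb.1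
  obtain ⟨a, ⟨ha, ham⟩, hamin⟩ := Set.exists_min_image _ (fun b => ⟪b, x₀⟫_ℝ) hfin2
    ⟨δ, hδ, by rw [hm, div_mul_cancel₀ _ hδγ.ne']⟩
  have haγ : 0 < ⟪a, γ⟫_ℝ := pos_of_mul_pos_right (ham ▸ ha.2) hmpos.le
  refine ⟨a, ⟨ha, fun b hb hba => ?_⟩, haγ⟩
  by_contra hneg
  have hb' := neg_mem_posRoots hx₀ (map_mem_roots ha.1.2 hb.1) hneg
  set b' := -refl a b with hb'def
  have hsum : b + b' = (2 * ⟪a, b⟫_ℝ) • a := by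
    rw [hb'def, refl_apply ha.1.1]; module
  have hlt := (inner_lt_one_iff_real_of_norm_eq_one ha.1.1 hb.1.1).2 hba.symm
  have h1 : ⟪b, x₀⟫_ℝ + ⟪b', x₀⟫_ℝ = 2 * ⟪a, b⟫_ℝ * ⟪a, x₀⟫_ℝ := by
    rw [← inner_add_left, hsum, inner_smul_left]; rfl
  have h2 : ⟪b, γ⟫_ℝ + ⟪b', γ⟫_ℝ = 2 * ⟪a, b⟫_ℝ * ⟪a, γ⟫_ℝ := by
    rw [← inner_add_left, hsum, inner_smul_left]; rfl
  -- If b and b' = -s_a b were both positive, they would vanish at x₀ - m γ because b + b' does, so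
  -- each has height at least that of a. But their heights sum to 2⟪a, b⟫ times that of a, and ⟪a,
  -- b⟫ < 1.
  have h3 := hle b hb
  have h4 := hle b' hb'
  have h5 : m * ⟪b, γ⟫_ℝ + m * ⟪b', γ⟫_ℝ = ⟪b, x₀⟫_ℝ + ⟪b', x₀⟫_ℝ := by
    rw [← mul_add, h2, h1, ← ham]; ring
  have h6 := hamin b ⟨hb, by linarith⟩
  have h7 := hamin b' ⟨hb', by linarith⟩
  nlinarith [ha.2]

/-- The reflections of the simple roots. -/
def simpleReflections (W : Subgroup (V ≃ₗᵢ[ℝ] V)) (x₀ : V) : Set (V ≃ₗᵢ[ℝ] V) :=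
  refl '' simpleRoots W x₀

/-- In a counterexample of least height, reflecting in a simple root with positive inner product
gives a lower positive root, whose reflection is a conjugate. -/
lemma refl_mem_closure_simpleReflections [FiniteDimensional ℝ V] [Finite W] (hx₀ : x₀ ∈ regularPoints W) {γ : V}
    (hγ : γ ∈ posRoots W x₀) : refl γ ∈ Subgroup.closure (simpleReflections W x₀) := by
  by_contra hbad
  have hfin : {δ | δ ∈ posRoots W x₀ ∧ refl δ ∉ Subgroup.closure (simpleReflections W x₀)}.Finite :=
    finite_posRoots.subset fun δ hδ => hδ.1
  obtain ⟨δ, ⟨hδ, hδbad⟩, hmin⟩ := Set.exists_min_image _ (fun δ => ⟪δ, x₀⟫_ℝ) hfin ⟨γ, hγ, hbad⟩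
  obtain ⟨a, ha, haδ⟩ := exists_simple_inner_pos hx₀ hδ
  have hamem : refl a ∈ Subgroup.closure (simpleReflections W x₀) :=
    Subgroup.subset_closure ⟨a, ha, rfl⟩
  have hne : δ ≠ a := by rintro rfl; exact hδbad hamem
  have hpos := ha.2 δ hδ hne
  have hgood : refl (refl a δ) ∈ Subgroup.closure (simpleReflections W x₀) := by
    by_contra hb
    have h1 := hmin _ ⟨hpos, hb⟩
    rw [refl_apply ha.1.1.1, inner_sub_left, inner_smul_left] at h1
    have h2 : 0 < 2 * ⟪a, δ⟫_ℝ * ⟪a, x₀⟫_ℝ := by have := ha.1.2; positivity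
    simp only [conj_trivial] at h1
    linarith
  rw [refl_map _ hδ.1.1] at hgood
  have h3 := Subgroup.mul_mem _ (Subgroup.mul_mem _ (Subgroup.inv_mem _ hamem) hgood) hamem
  exact hδbad (by simpa [mul_assoc] using h3)

lemma exists_posRoot_refl_eq [FiniteDimensional ℝ V] (hx₀ : x₀ ∈ regularPoints W) {v : V} (hv : v ≠ 0) (hvW : refl v ∈ W) :
    ∃ r : ℝ, r ≠ 0 ∧ r • v ∈ posRoots W x₀ := by
  have hn : ‖v‖⁻¹ ≠ 0 := inv_ne_zero (norm_ne_zero_iff.2 hv)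
  have hu : ‖v‖⁻¹ • v ∈ roots W := by
    refine ⟨?_, by rwa [refl_smul hn]⟩
    rw [norm_smul, norm_inv, norm_norm, inv_mul_cancel₀ (norm_ne_zero_iff.2 hv)]
  by_cases hpos : ‖v‖⁻¹ • v ∈ posRoots W x₀
  · exact ⟨_, hn, hpos⟩
  · refine ⟨-‖v‖⁻¹, neg_ne_zero.2 hn, ?_⟩
    rw [neg_smul]
    exact neg_mem_posRoots hx₀ hu hpos

lemma IsFiniteReflectionGroup.le_closure_simpleReflections [FiniteDimensional ℝ V] (hW : IsFiniteReflectionGroup W)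
    (hx₀ : x₀ ∈ regularPoints W) : W ≤ Subgroup.closure (simpleReflections W x₀) := by
  have := hW.finite
  conv_lhs => rw [← hW.closure_reflections]
  rw [Subgroup.closure_le]
  rintro s ⟨hsW, v, hv, rfl⟩
  obtain ⟨r, hr, hrv⟩ := exists_posRoot_refl_eq hx₀ hv hsW
  have := refl_mem_closure_simpleReflections hx₀ hrv
  rwa [refl_smul hr] at this

lemma IsFiniteReflectionGroup.exists_list [FiniteDimensional ℝ V] (hW : IsFiniteReflectionGroup W)
    (hx₀ : x₀ ∈ regularPoints W) {w : V ≃ₗᵢ[ℝ] V} (hw : w ∈ W) :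
    ∃ l : List (V ≃ₗᵢ[ℝ] V), (∀ s ∈ l, s ∈ simpleReflections W x₀) ∧ l.prod = w := by
  have hmem := hW.le_closure_simpleReflections hx₀ hw
  rw [← Subgroup.mem_toSubmonoid, Subgroup.closure_toSubmonoid] at hmem
  obtain ⟨l, hl, hprod⟩ := Submonoid.exists_list_of_mem_closure hmem
  refine ⟨l, fun s hs => (hl s hs).elim id ?_, hprod⟩
  rintro ⟨a, ha, has⟩
  refine ⟨a, ha, ?_⟩
  rw [← refl_inv, has, inv_inv]

lemma list_prod_mem {l : List (V ≃ₗᵢ[ℝ] V)} (hl : ∀ s ∈ l, s ∈ simpleReflections W x₀) :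
    l.prod ∈ W := by
  refine W.list_prod_mem fun s hs => ?_
  obtain ⟨a, ha, rfl⟩ := hl s hs
  exact ha.1.1.2

/-- The exchange condition. -/
lemma exists_exchange {α : V} (hα : α ∈ simpleRoots W x₀)
    (l : List (V ≃ₗᵢ[ℝ] V)) (hl : ∀ s ∈ l, s ∈ simpleReflections W x₀)
    (hneg : l.prod α ∉ posRoots W x₀) :
    ∃ l' : List (V ≃ₗᵢ[ℝ] V), (∀ s ∈ l', s ∈ simpleReflections W x₀) ∧
      l'.length < l.length ∧ l'.prod = l.prod * refl α := by
  induction l with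
  | nil => exact absurd hα.1 hneg
  | cons s t ih =>
    have hs := hl s (by simp)
    have ht : ∀ s ∈ t, s ∈ simpleReflections W x₀ := fun u hu => hl u (by simp [hu])
    by_cases hpos : t.prod α ∈ posRoots W x₀
    · obtain ⟨β, hβ, rfl⟩ := hs
      -- The reflection in β makes no positive root other than β negative. So the suffix t sends α
      -- to β and conjugates s_α to s_β, and the letter cancels.
      have heq : t.prod α = β := by
        by_contra hne
        refine hneg ?_
        rw [List.prod_cons]
        exact hβ.2 _ hpos hne
      refine ⟨t, ht, by simp, ?_⟩
      rw [List.prod_cons, ← heq, refl_map _ hα.1.1.1]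
      simp only [mul_assoc, inv_mul_cancel_left, refl_mul_self, mul_one]
    · obtain ⟨t', ht', hlen, hprod⟩ := ih ht hpos
      refine ⟨s :: t', ?_, by simpa using hlen, ?_⟩
      · intro u hu
        rcases List.mem_cons.1 hu with rfl | hu
        · exact hs
        · exact ht' u hu
      · rw [List.prod_cons, List.prod_cons, hprod, mul_assoc]

/-- Induction on word length. If t α is positive for the last letter s_α, both chamber conditions
force ⟪α, y⟫ = 0 and the letter can be dropped; otherwise exchange shortens the word. -/
lemma list_prod_fixes_of_mem_chamber {y : V}
    (hy : y ∈ chamber W x₀) (l : List (V ≃ₗᵢ[ℝ] V)) (hl : ∀ s ∈ l, s ∈ simpleReflections W x₀)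
    (hly : l.prod y ∈ chamber W x₀) : l.prod y = y := by
  induction hn : l.length using Nat.strong_induction_on generalizing l with
  | _ n ih =>
    subst hn
    rcases List.eq_nil_or_concat l with rfl | ⟨t, s, rfl⟩
    · rfl
    have hs := hl s (by simp)
    have ht : ∀ u ∈ t, u ∈ simpleReflections W x₀ := fun u hu => hl u (by simp [hu])
    obtain ⟨α, hα, rfl⟩ := hs
    have hprod : (t.concat (refl α)).prod = t.prod * refl α := by simp
    have htα : t.prod α ∈ roots W := map_mem_roots (list_prod_mem ht) hα.1.1
    by_cases hpos : t.prod α ∈ posRoots W x₀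
    · have h1 := hly _ hpos
      rw [hprod] at h1 hly ⊢
      change 0 ≤ ⟪t.prod α, t.prod (refl α y)⟫_ℝ at h1
      rw [t.prod.inner_map_map, refl_apply hα.1.1.1, inner_sub_right, inner_smul_right,
        real_inner_self_eq_norm_sq, hα.1.1.1] at h1
      have h2 := hy α hα.1
      have h3 : ⟪α, y⟫_ℝ = 0 := by linarith
      have h4 : refl α y = y := by rw [refl_apply hα.1.1.1, h3]; simp
      change t.prod (refl α y) ∈ chamber W x₀ at hly
      change t.prod (refl α y) = y
      rw [h4] at hly ⊢
      exact ih t.length (by simp) t ht hly rfl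
    · obtain ⟨t', ht', hlen, hprod'⟩ := exists_exchange hα t ht hpos
      rw [hprod, ← hprod'] at hly ⊢
      exact ih t'.length (hlen.trans (by simp)) t' ht' hly rfl

lemma convex_openChamber : Convex ℝ (openChamber W x₀) := by
  intro y hy z hz a b ha hb hab v hv
  rw [inner_add_right, inner_smul_right, inner_smul_right]
  rcases ha.eq_or_lt with rfl | ha
  · rw [zero_add] at hab
    subst hab
    simpa using hz v hv
  · have h1 := mul_pos ha (hy v hv)
    have h2 := mul_nonneg hb (hz v hv).le
    linarith

lemma self_mem_openChamber : x₀ ∈ openChamber W x₀ := fun _ hv => hv.2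

lemma connectedComponentIn_regularPoints [FiniteDimensional ℝ V] (hx₀ : x₀ ∈ regularPoints W) :
    connectedComponentIn (regularPoints W) x₀ = openChamber W x₀ := by
  apply Set.Subset.antisymm
  · intro y hy v hv
    by_contra hneg
    have hconn := (isPreconnected_connectedComponentIn (F := regularPoints W) (x := x₀)).image
      (fun z => ⟪v, z⟫_ℝ) (by fun_prop)
    have hx : x₀ ∈ connectedComponentIn (regularPoints W) x₀ := mem_connectedComponentIn hx₀
    have h0 : (0 : ℝ) ∈ (fun z => ⟪v, z⟫_ℝ) '' connectedComponentIn (regularPoints W) x₀ :=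
      hconn.ordConnected.out (Set.mem_image_of_mem _ hy) (Set.mem_image_of_mem _ hx)
        ⟨not_lt.1 hneg, hv.2.le⟩
    obtain ⟨z, hz, hz0⟩ := h0
    exact inner_ne_zero_of_regular (connectedComponentIn_subset _ _ hz) hv.1 hz0
  · refine convex_openChamber.isPreconnected.subset_connectedComponentIn self_mem_openChamber ?_
    intro y hy v hv hvW hyv
    obtain ⟨r, hr, hrv⟩ := exists_posRoot_refl_eq hx₀ hv hvW
    have h1 := hy _ hrv
    rw [inner_smul_left, Submodule.mem_orthogonal_singleton_iff_inner_right.1 hyv, mul_zero] at h1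
    exact lt_irrefl _ h1

lemma closure_openChamber : closure (openChamber W x₀) = chamber W x₀ := by
  apply Set.Subset.antisymm
  · refine closure_minimal (fun y hy v hv => (hy v hv).le) ?_
    have : chamber W x₀ = ⋂ v ∈ posRoots W x₀, {y | 0 ≤ ⟪v, y⟫_ℝ} := by
      ext y; simp [chamber]
    rw [this]
    exact isClosed_biInter fun v _ => isClosed_le continuous_const (by fun_prop)
  · intro y hy
    have hlim : Filter.Tendsto (fun t : ℝ => y + t • x₀) (nhdsWithin 0 (Set.Ioi 0))
        (nhds (y + (0 : ℝ) • x₀)) :=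
      (Continuous.tendsto (by fun_prop) 0).mono_left nhdsWithin_le_nhds
    rw [zero_smul, add_zero] at hlim
    refine mem_closure_of_tendsto hlim ?_
    filter_upwards [self_mem_nhdsWithin] with t ht v hv
    rw [inner_add_right, inner_smul_right]
    exact add_pos_of_nonneg_of_pos (hy v hv) (mul_pos ht hv.2)

/-- The point of an orbit nearest to a point of the open chamber is in the closed chamber. -/
lemma exists_max_mem_chamber [Finite W] {c : V} (hc : c ∈ openChamber W x₀) (y : V) :
    ∃ g ∈ W, g y ∈ chamber W x₀ ∧ ∀ w ∈ W, ⟪w y, c⟫_ℝ ≤ ⟪g y, c⟫_ℝ := by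
  obtain ⟨g, hg, hmax⟩ := Set.exists_max_image (W : Set (V ≃ₗᵢ[ℝ] V)) (fun g => ⟪g y, c⟫_ℝ)
    (Set.toFinite _) ⟨1, W.one_mem⟩
  refine ⟨g, hg, fun v hv => ?_, hmax⟩
  have h1 := hmax (refl v * g) (W.mul_mem hv.1.2 hg)
  change ⟪refl v (g y), c⟫_ℝ ≤ ⟪g y, c⟫_ℝ at h1
  rw [refl_apply hv.1.1, inner_sub_left, inner_smul_left] at h1
  simp only [conj_trivial] at h1
  have h2 := hc v hv
  by_contra hneg
  nlinarith [mul_pos (neg_pos.2 (not_le.1 hneg)) h2]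

/-- A fundamental cone of a finite reflection group is a Dirichlet domain. -/
lemma IsFundamentalCone.isDirichlet [FiniteDimensional ℝ V] (hW : IsFiniteReflectionGroup W) {C : PointedCone ℝ V}
    (hC : IsFundamentalCone W C) : IsDirichlet W C := by
  obtain ⟨x₀, hx₀, hCx⟩ := hC
  have hfin := hW.finite
  rw [connectedComponentIn_regularPoints hx₀, closure_openChamber] at hCx
  have hmem : ∀ y, y ∈ C ↔ y ∈ chamber W x₀ := fun y => by rw [← hCx]; rfl
  refine ⟨hfin, fun y => ?_, fun w hw y hy c hc => ?_⟩
  · obtain ⟨g, hg, hgy, -⟩ := exists_max_mem_chamber (self_mem_openChamber (W := W)) y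
    exact ⟨g, hg, (hmem _).2 hgy⟩
  · rw [hmem] at hy hc
    rw [← closure_openChamber] at hc
    -- For c in the open chamber, a maximizer of ⟪·, c⟫ on the orbit of y lies in the chamber, so it
    -- is y itself; continuity covers the closure.
    refine closure_minimal (t := {c | ⟪w y, c⟫_ℝ ≤ ⟪y, c⟫_ℝ}) (fun c hc => ?_)
      (isClosed_le (by fun_prop) (by fun_prop)) hc
    obtain ⟨g, hg, hgy, hmax⟩ := exists_max_mem_chamber hc y
    obtain ⟨l, hl, rfl⟩ := hW.exists_list hx₀ hg
    have hfix := list_prod_fixes_of_mem_chamber hy l hl hgy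
    have := hmax w hw
    rwa [hfix] at this

end

end ReflectionCone

theorem theorem1 {V : Type*} [NormedAddCommGroup V] [InnerProductSpace ℝ V]
    [FiniteDimensional ℝ V] (n : ℕ) (hn : Module.finrank ℝ V = n)
    (W : Subgroup (V ≃ₗᵢ[ℝ] V)) (hW : ReflectionCone.IsFiniteReflectionGroup W)
    (C : PointedCone ℝ V) (hC : ReflectionCone.IsFundamentalCone W C)
    (k : ℕ) (hk : k ≤ n) :
    (ReflectionCone.faces C k).Finite ∧
      ∑ᶠ F ∈ ReflectionCone.faces C k,
          ReflectionCone.angleMeasure F *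
            ReflectionCone.angleMeasure
              (ReflectionCone.dualCone (ReflectionCone.coneQuot C F)) =
        ((ReflectionCone.fixedDim W k).ncard : ℝ) / (Nat.card W : ℝ) :=
  have h := hC.isDirichlet hW
  ⟨h.faces_finite k, h.sum_angleMeasure_faces k⟩
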